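/- **Conventions.** Minkowski metric $\mathrm{diag}(1,-1,-1,-1)$; $\epsilon_{12}=1=-\epsilon_{21}$, $\epsilon^{ab}=-\epsilon_{ab}$, $\psi^a=\epsilon^{ab}\psi_b$ (the same $\epsilon_{jk}$ is used for $SU(2)$ indices); $\sigma^0=1$, $\sigma^i$ the Pauli matrices; all indices $a,b,j,k,\dots$ take the values $1,2$ and repeated indices are summed. Fields are smeared with Schwartz functions on $\mathbb R^4$ and take values in a non-zero complex $*$-algebra $\mathcal A$ (e.g. operators leaving, with their adjoints, a common dense domain invariant); $\phi^*(f)=\phi(\bar f)^*$. For $m\ge 0$ and $\omega(p)=\sqrt{m^2+|p|^2}$ put $$D_m^{(+)}(x)=\frac{i}{(2\pi)^3}\int\frac{d^3p}{2\omega(p)}e^{-i(\omega(p)x^0-p\cdot \mathbf x)},\qquad D_m(x)=D_m^{(+)}(x)-D_m^{(+)}(-x).$$ **The multiplet.** Let $(z,D,F_{ab},C_{jk},\lambda_{ja},\chi_{ja})$, with $F_{ab}=F_{ba}$, $C_{jk}=C_{kj}$, be an $N=2$ multiplet without central charges: there are supercharges $Q_{ja}$, with $\bar Q_{j\bar a}=Q_{ja}^*$,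 and self-adjoint $P_\mu$ in $\mathcal A$ with $[Q_{ja},P_\mu]=0$, $\{Q_{ja},Q_{kb}\}=0$, $\{Q_{ja},\bar Q_{k\bar b}\}=2\delta_{jk}\sigma^\mu_{a\bar b}P_\mu$, $[P_\mu,\phi]=-i\partial_\mu\phi$ for all fields $\phi$ of the multiplet, and $$i[Q_{ja},z]=\chi_{ja},\quad [\bar Q_{j\bar a},z]=0,\quad [Q_{ja},F_{bc}]=\epsilon_{ab}\lambda_{jc}+\epsilon_{ac}\lambda_{jb},\quad [\bar Q_{j\bar a},F_{bc}]=-i\epsilon_{jk}(\sigma^\mu_{c\bar a}\partial_\mu\chi_{kb}+\sigma^\mu_{b\bar a}\partial_\mu\chi_{kc}),$$ $$[Q_{ja},C_{kl}]=-(\epsilon_{jk}\lambda_{la}+\epsilon_{jl}\lambda_{ka}),\quad [\bar Q_{j\bar a},C_{kl}]=i\sigma^\mu_{b\bar a}\partial_\mu(\delta_{jk}\chi_l^b+\delta_{jl}\chi_k^b),\quad [Q_{ja},D]=0,\quad [\bar Q_{j\bar a},D]=2i\epsilon_{jk}\sigma^\mu_{b\bar a}\partial_\mu\lambda_k^b,$$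 $$\{Q_{ja},\chi_{kb}\}=\epsilon_{jk}F_{ab}+\epsilon_{ab}C_{jk},\quad \{Q_{ja},\bar\chi_{k\bar b}\}=2\delta_{jk}\sigma^\mu_{a\bar b}\partial_\mu z^*,\quad \{Q_{ja},\lambda_{kb}\}=\epsilon_{jk}\epsilon_{ab}D,$$ $$\{\bar Q_{j\bar b},\lambda_{ka}\}=i(\delta_{jk}\sigma^\mu_{c\bar b}\epsilon^{cd}\partial_\mu F_{ad}+\epsilon_{jl}\sigma^\mu_{a\bar b}\partial_\mu C_{lk}).$$ The bosonic fields $z,D,F,C$ commute with the fermionic fields $\lambda,\chi$ and their adjoints. Suppose that $z$ is a free complex scalar field of mass $m\ge0$, i.e. $(\partial^2+m^2)z=0$, $[z(x),z(y)]=0$, $[z(x),z^*(y)]=-iD_m(x-y)$, and that $[z(x),D(y)]=\alpha D_m(x-y)$ with $\alpha\in\mathbb R$. **Corollary.** Put $$\mathcal C_{jk}=\tfrac12\bigl(C_{jk}+\epsilon_{jl}\epsilon_{km}C^*_{lm}\bigr),\qquad \mathcal D_{jk}=\tfrac i2\bigl(C_{jk}-\epsilon_{jl}\epsilon_{km}C^*_{lm}\bigr).$$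 1. The map $C\mapsto(\mathcal C,\mathcal D)$ is a bijection from the symmetric families $C_{jk}=C_{kj}$ of fields onto the pairs of symmetric families satisfying $\mathcal C^*_{jk}=\epsilon_{jl}\epsilon_{km}\mathcal C_{lm}$, $\mathcal D^*_{jk}=\epsilon_{jl}\epsilon_{km}\mathcal D_{lm}$; in particular the $\mathcal C,\mathcal D$ of the multiplet satisfy these reality conditions. The decomposition is $SU(2)$-covariant: for every homomorphism $U\mapsto V_U$ from $SU(2)$ to the unitary elements of $\mathcal A$ with $V_U^{-1}C_{jk}V_U=U_{jl}U_{km}C_{lm}$ for all $U$, both $\mathcal C$ and $\mathcal D$ transform in the same way. 2. The causal commutators are $$[\mathcal C_{jk}(x),\mathcal C^*_{lm}(y)]=-\tfrac i2(2m^2+\alpha)(\delta_{jl}\delta_{km}+\delta_{jm}\delta_{kl})D_m(x-y),$$ $$[\mathcal D_{jk}(x),\mathcal D^*_{lm}(y)]=-\tfrac i2(2m^2-\alpha)(\delta_{jl}\delta_{km}+\delta_{jm}\delta_{kl})D_m(x-y),\qquad[\mathcal C_{jk}(x),\mathcal D_{lm}(y)]=0.$$ 3. Let the two-point functions of $\mathcal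 C,\mathcal D$ and their adjoints be obtained from the commutators by the substitution $D_m\to D_m^{(+)}$. The norm squared, computed from them, of the one-particle state $\int\bigl(f_{jk}(x)\,\mathcal C^*_{jk}(x)+g_{jk}(x)\,\mathcal D^*_{jk}(x)\bigr)\Omega\,dx$ is strictly positive for all test functions $f_{jk}=f_{kj}$, $g_{jk}=g_{kj}$ whose Fourier transforms do not all vanish on the upper hyperboloid of mass $m$, if and only if $$-2m^2<\alpha<2m^2 .$$ 4. Consequently, consider a representation of $\mathcal A$ by operators on a dense domain of a Hilbert space, where $*$ is the Hilbert space adjoint, with a unit vacuum vector $\Omega$ in the domain for which the two-point functions are those of item 3, and in which $\mathcal C,\mathcal D$ are linearly independent up to symmetry and the equation of motion (the states of item 3 are non-zero). Such a representation can exist only if $-2m^2<\alpha<2m^2$. In particular, for $\alpha=2m^2$ the multiplet has no such representation. -/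

import Mathlib

open scoped SchwartzMap LineDeriv InnerProductSpace
open Complex MeasureTheory

noncomputable section

namespace SusyN2

/-! ### Minkowski space, test functions and the Pauli-Jordan distribution -/

/-- Minkowski space `ℝ⁴`; coordinate `0` is time, the metric is `diag(1,-1,-1,-1)`. -/
abbrev Spacetime := EuclideanSpace ℝ (Fin 4)

/-- Spatial momenta. -/
abbrev Momentum := EuclideanSpace ℝ (Fin 3)

/-- Complex Schwartz test functions on Minkowski space. -/
abbrev TestFn := 𝓢(Spacetime, ℂ)

/-- The pointwise complex conjugate of a test function. -/
def conjTest : TestFn →L[ℝ] TestFn :=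
  SchwartzMap.postcompCLM (𝕜 := ℝ) (Complex.conjCLE : ℂ →L[ℝ] ℂ)

@[simp] theorem conjTest_apply (f : TestFn) (x : Spacetime) :
    conjTest f x = (starRingEnd ℂ) (f x) := rfl

/-- The energy `ω(p) = √(m² + |p|²)`. -/
def energy (m : ℝ) (p : Momentum) : ℝ := Real.sqrt (m ^ 2 + ‖p‖ ^ 2)

/-- The Minkowski product `k · x` of the on-shell momentum `k = (ω(p), p)` with `x`. -/
def shellDot (m : ℝ) (p : Momentum) (x : Spacetime) : ℝ :=
  energy m p * x 0 - ∑ i : Fin 3, p i * x i.succ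

/-- The Fourier transform of a test function on the upper mass hyperboloid,
`∫ f(x) e^{i k·x} dx` with `k = (ω(p), p)`. -/
def upperShell (m : ℝ) (f : TestFn) (p : Momentum) : ℂ :=
  ∫ x : Spacetime, f x * Complex.exp (I * (shellDot m p x : ℂ))

/-- The Fourier transform of a test function on the lower mass hyperboloid,
`∫ f(x) e^{- i k·x} dx` with `k = (ω(p), p)`. -/
def lowerShell (m : ℝ) (f : TestFn) (p : Momentum) : ℂ :=
  ∫ x : Spacetime, f x * Complex.exp (-(I * (shellDot m p x : ℂ)))

/-- The positive frequency part
`D_m⁽⁺⁾(x) = i (2π)⁻³ ∫ d³p / (2 ω(p)) e^{- i k·x}`, smeared as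
`∫∫ f(x) D_m⁽⁺⁾(x - y) g(y) dx dy`. -/
def pauliJordanPos (m : ℝ) (f g : TestFn) : ℂ :=
  I * ∫ p : Momentum, (((2 * Real.pi) ^ 3 * (2 * energy m p))⁻¹ : ℝ) *
    (lowerShell m f p * upperShell m g p)

/-- The Pauli-Jordan causal distribution `D_m(x) = D_m⁽⁺⁾(x) - D_m⁽⁺⁾(-x)`, smeared as
`∫∫ f(x) D_m(x - y) g(y) dx dy`. -/
def pauliJordan (m : ℝ) (f g : TestFn) : ℂ :=
  pauliJordanPos m f g - pauliJordanPos m g f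

/-! ### Fields -/

section Fields

variable {A : Type*} [Ring A] [StarRing A] [Algebra ℂ A] [StarModule ℂ A]

/-- A quantum field with values in a `*`-algebra `A` (for instance the operators which leave,
together with their adjoints, a common dense domain invariant), smeared with test functions. -/
abbrev Field (A : Type*) [Ring A] [Algebra ℂ A] := TestFn →ₗ[ℂ] A

/-- The adjoint field, `φ*(f) = φ(f̄)*`. -/
def adj (φ : Field A) : Field A where
  toFun f := star (φ (conjTest f))
  map_add' f g := by simp
  map_smul' c f := by
    have h : conjTest (c • f) = (starRingEnd ℂ c) • conjTest f := by
      ext x; simp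
    simp [h]

/-- The derivative `∂_μ φ`, that is `(∂_μ φ)(f) = - φ(∂_μ f)`. -/
def pd {A : Type*} [Ring A] [Algebra ℂ A] (μ : Fin 4) (φ : Field A) : Field A :=
  -(φ ∘ₗ (LineDeriv.lineDerivOpCLM ℂ TestFn
      (EuclideanSpace.single μ (1 : ℝ) : Spacetime)).toLinearMap)

/-- `[φ(x), ψ(y)] = K(x, y) 1`. -/
def HasCommutator {A : Type*} [Ring A] [Algebra ℂ A] (φ ψ : Field A)
    (K : TestFn → TestFn → ℂ) : Prop :=
  ∀ f g, φ f * ψ g - ψ g * φ f = algebraMap ℂ A (K f g)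

/-- `[X, φ(x)]` for an element `X` of the algebra. -/
def commWith {A : Type*} [Ring A] [Algebra ℂ A] (X : A) (φ : Field A) : Field A :=
  LinearMap.mulLeft ℂ X ∘ₗ φ - LinearMap.mulRight ℂ X ∘ₗ φ

/-- `{X, φ(x)}` for an element `X` of the algebra. -/
def anticommWith {A : Type*} [Ring A] [Algebra ℂ A] (X : A) (φ : Field A) : Field A :=
  LinearMap.mulLeft ℂ X ∘ₗ φ + LinearMap.mulRight ℂ X ∘ₗ φ

end Fields

/-! ### Spinor conventions -/

/-- `ε_{ab}`, with `ε₁₂ = 1` (the indices `1, 2` are `0, 1 : Fin 2`); used both for Weyl and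
for `SU(2)` indices. -/
def eps (a b : Fin 2) : ℂ := (!![0, 1; -1, 0] : Matrix (Fin 2) (Fin 2) ℂ) a b

/-- `ε^{ab} = - ε_{ab}`. -/
def epsUp (a b : Fin 2) : ℂ := -eps a b

/-- Kronecker's `δ_{jk}`. -/
def delta (j k : Fin 2) : ℂ := if j = k then 1 else 0

/-- The matrices `σ^μ` with `σ⁰ = 1` and `σ^i` the Pauli matrices. -/
def sigma : Fin 4 → Matrix (Fin 2) (Fin 2) ℂ :=
  ![1, !![0, 1; 1, 0], !![0, -I; I, 0], !![1, 0; 0, -1]]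

section Fields

variable {A : Type*} [Ring A] [StarRing A] [Algebra ℂ A] [StarModule ℂ A]

/-- `σ^μ_{ab} ∂_μ φ`. -/
def sigmaPd {A : Type*} [Ring A] [Algebra ℂ A] (a b : Fin 2) (φ : Field A) : Field A :=
  ∑ μ, sigma μ a b • pd μ φ

/-- Raising a Weyl index: `ψ^a = ε^{ab} ψ_b`. -/
def raise {A : Type*} [Ring A] [Algebra ℂ A] (ψ : Fin 2 → Field A) (a : Fin 2) : Field A :=
  ∑ b, epsUp a b • ψ b

/-- A complex scalar field of mass `m`: it solves the Klein-Gordon equation, `[z(x), z(y)] = 0`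
and `[z(x), z*(y)] = - i D_m(x - y)`. -/
structure IsFreeComplexScalar (m : ℝ) (z : Field A) : Prop where
  kleinGordon :
    pd 0 (pd 0 z) - ∑ i : Fin 3, pd i.succ (pd i.succ z) + ((m : ℂ) ^ 2) • z = 0
  comm : HasCommutator z z fun _ _ => 0
  comm_adj : HasCommutator z (adj z) fun f g => -I * pauliJordan m f g

/-- The `N = 2` multiplet `(z, D, F_{ab}, C_{jk}, λ_{ja}, χ_{ja})` without central charges:
supercharges `Q_{ja}`, translation generators `P_μ`, fields, and the action of the supercharges
on the fields. Here `Q̄_{ja} = star (Q j a)`, and conjugate spinors are adjoint fields. -/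
structure Multiplet (A : Type*) [Ring A] [StarRing A] [Algebra ℂ A] [StarModule ℂ A] where
  /-- the supercharges -/
  Q : Fin 2 → Fin 2 → A
  /-- the generators of translations -/
  P : Fin 4 → A
  /-- the scalar field `z` -/
  z : Field A
  /-- the scalar field `D` -/
  d : Field A
  /-- the fields `F_{ab}` -/
  F : Fin 2 → Fin 2 → Field A
  /-- the fields `C_{jk}` -/
  C : Fin 2 → Fin 2 → Field A
  /-- the spinor fields `λ_{ja}` -/
  lam : Fin 2 → Fin 2 → Field A
  /-- the spinor fields `χ_{ja}` -/
  chi : Fin 2 → Fin 2 → Field A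
  F_symm : ∀ a b, F a b = F b a
  C_symm : ∀ j k, C j k = C k j
  -- the supersymmetry algebra
  P_star : ∀ μ, star (P μ) = P μ
  Q_P : ∀ j a μ, Q j a * P μ = P μ * Q j a
  Q_Q : ∀ j a k b, Q j a * Q k b + Q k b * Q j a = 0
  Q_Qbar : ∀ j a k b, Q j a * star (Q k b) + star (Q k b) * Q j a =
    ∑ μ, (2 * delta j k * sigma μ a b) • P μ
  -- `P_μ` generates translations
  P_z : ∀ μ, commWith (P μ) z = -I • pd μ z
  P_d : ∀ μ, commWith (P μ) d = -I • pd μ d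
  P_F : ∀ μ a b, commWith (P μ) (F a b) = -I • pd μ (F a b)
  P_C : ∀ μ j k, commWith (P μ) (C j k) = -I • pd μ (C j k)
  P_lam : ∀ μ j a, commWith (P μ) (lam j a) = -I • pd μ (lam j a)
  P_chi : ∀ μ j a, commWith (P μ) (chi j a) = -I • pd μ (chi j a)
  -- the action of the supercharges
  Q_z : ∀ j a, I • commWith (Q j a) z = chi j a
  Qbar_z : ∀ j a, commWith (star (Q j a)) z = 0
  Q_F : ∀ j a b c, commWith (Q j a) (F b c) = eps a b • lam j c + eps a c • lam j b
  Qbar_F : ∀ j a b c, commWith (star (Q j a)) (F b c) =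
    -I • ∑ k, eps j k • (sigmaPd c a (chi k b) + sigmaPd b a (chi k c))
  Q_C : ∀ j a k l, commWith (Q j a) (C k l) = -(eps j k • lam l a + eps j l • lam k a)
  Qbar_C : ∀ j a k l, commWith (star (Q j a)) (C k l) =
    I • ∑ b, sigmaPd b a (delta j k • raise (chi l) b + delta j l • raise (chi k) b)
  Q_d : ∀ j a, commWith (Q j a) d = 0
  Qbar_d : ∀ j a, commWith (star (Q j a)) d =
    (2 * I) • ∑ k, ∑ b, eps j k • sigmaPd b a (raise (lam k) b)
  Q_chi : ∀ j a k b, anticommWith (Q j a) (chi k b) = eps j k • F a b + eps a b • C j k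
  Q_chibar : ∀ j a k b, anticommWith (Q j a) (adj (chi k b)) =
    (2 * delta j k) • sigmaPd a b (adj z)
  Q_lam : ∀ j a k b, anticommWith (Q j a) (lam k b) = (eps j k * eps a b) • d
  Qbar_lam : ∀ j b k a, anticommWith (star (Q j b)) (lam k a) =
    I • (delta j k • (∑ c, ∑ e, epsUp c e • sigmaPd c b (F a e)) +
      ∑ l, eps j l • sigmaPd a b (C l k))
  -- Bosonic and Fermionic fields commute
  bose_fermi : ∀ b : Field A, (b = z ∨ b = d ∨ (∃ a c, b = F a c) ∨ (∃ j k, b = C j k)) →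
    ∀ ψ : Field A, ((∃ j a, ψ = lam j a) ∨ (∃ j a, ψ = chi j a)) →
      HasCommutator b ψ (fun _ _ => 0) ∧ HasCommutator b (adj ψ) (fun _ _ => 0)

/-! ### The decomposition of `C_{jk}` -/

/-- `ε_{jl} ε_{km} C*_{lm}`. -/
def flipAdj (C : Fin 2 → Fin 2 → Field A) (j k : Fin 2) : Field A :=
  ∑ l, ∑ n, (eps j l * eps k n) • adj (C l n)

/-- `𝒞_{jk} = ½ (C_{jk} + ε_{jl} ε_{km} C*_{lm})`. -/
def calC (C : Fin 2 → Fin 2 → Field A) (j k : Fin 2) : Field A :=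
  (1 / 2 : ℂ) • (C j k + flipAdj C j k)

/-- `𝒟_{jk} = (i/2) (C_{jk} - ε_{jl} ε_{km} C*_{lm})`. -/
def calD (C : Fin 2 → Fin 2 → Field A) (j k : Fin 2) : Field A :=
  (I / 2) • (C j k - flipAdj C j k)

/-- Symmetry `C_{jk} = C_{kj}`. -/
def IsSymm {A : Type*} [Ring A] [Algebra ℂ A] (C : Fin 2 → Fin 2 → Field A) : Prop :=
  ∀ j k, C j k = C k j

/-- The reality condition `X*_{jk} = ε_{jl} ε_{km} X_{lm}`. -/
def IsRealTensor (X : Fin 2 → Fin 2 → Field A) : Prop :=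
  ∀ j k, adj (X j k) = ∑ l, ∑ n, (eps j l * eps k n) • X l n

/-- `V_U⁻¹ X_{jk} V_U = U_{jl} U_{km} X_{lm}` for all `U ∈ SU(2)`. -/
def IsCovariant (V : Matrix.specialUnitaryGroup (Fin 2) ℂ →* unitary A)
    (X : Fin 2 → Fin 2 → Field A) : Prop :=
  ∀ (U : Matrix.specialUnitaryGroup (Fin 2) ℂ) (j k : Fin 2) (f : TestFn),
    star (V U : A) * X j k f * (V U : A) =
      ∑ l, ∑ n, ((U : Matrix (Fin 2) (Fin 2) ℂ) j l * (U : Matrix (Fin 2) (Fin 2) ℂ) k n) • X l n f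

/-! ### Positivity -/

/-- `W` is the two-point function `⟨Ω, φ(x) ψ(y) Ω⟩` of two fields with
`[φ(x), ψ(y)] = - i c D_m(x - y)`, obtained by the substitution `D_m → D_m⁽⁺⁾`. -/
def IsTwoPoint {A : Type*} [Ring A] [Algebra ℂ A] (m : ℝ) (φ ψ : Field A)
    (W : TestFn → TestFn → ℂ) : Prop :=
  ∃ c : ℂ, HasCommutator φ ψ (fun f g => -I * c * pauliJordan m f g) ∧
    ∀ f g, W f g = -I * c * pauliJordanPos m f g

/-- Families of test functions `f_{κ,jk}`, symmetric in `j, k`, which do not all vanish on the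
upper hyperboloid of mass `m`: these label the one-particle states which are formally non-zero,
i.e. not zero by symmetry or by the equation of motion. -/
def IsAdmissible {κ : Type*} (m : ℝ) (f : κ → Fin 2 → Fin 2 → TestFn) : Prop :=
  (∀ r j k, f r j k = f r k j) ∧ ∃ r j k p, upperShell m (f r j k) p ≠ 0

/-- The positivity condition for the symmetric tensor fields `Φ_{r,jk}`: the states
`Ψ = ∑ ∫ f_{r,jk}(x) Φ*_{r,jk}(x) Ω dx` have strictly positive norm squared, which is
computed from the two-point functions
`W_{r,jk;s,ln}(x,y) = ⟨Ω, Φ_{r,jk}(x) Φ*_{s,ln}(y) Ω⟩`. -/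
def PositivityCondition {κ : Type*} [Fintype κ] (m : ℝ) (Φ : κ → Fin 2 → Fin 2 → Field A) :
    Prop :=
  ∃ W : κ → Fin 2 → Fin 2 → κ → Fin 2 → Fin 2 → TestFn → TestFn → ℂ,
    (∀ r j k s l n, IsTwoPoint m (Φ r j k) (adj (Φ s l n)) (W r j k s l n)) ∧
    ∀ f : κ → Fin 2 → Fin 2 → TestFn, IsAdmissible m f →
      ∃ N : ℝ, 0 < N ∧
        ∑ r, ∑ j, ∑ k, ∑ s, ∑ l, ∑ n, W r j k s l n (conjTest (f r j k)) (f s l n) = (N : ℂ)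

/-- A Hilbert space representation of Fock type of the algebra `A`, with respect to the fields
`Φ_{r,jk}`: the algebra acts on a dense domain containing the vacuum, the star is the Hilbert
space adjoint, the vacuum two-point functions of the fields are obtained from the causal
commutators by `D_m → D_m⁽⁺⁾`, and the fields are linearly independent up to their symmetry
and the equation of motion. -/
structure FockRepresentation {κ : Type*} [Fintype κ] (m : ℝ)
    (Φ : κ → Fin 2 → Fin 2 → Field A)
    (H : Type*) [NormedAddCommGroup H] [InnerProductSpace ℂ H] [CompleteSpace H] where
  /-- the common domain -/
  dom : Submodule ℂ H
  dom_dense : Dense (dom : Set H)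
  /-- the action of the algebra -/
  rep : A →ₐ[ℂ] Module.End ℂ dom
  rep_star : ∀ (a : A) (u v : dom), ⟪(rep a u : H), (v : H)⟫_ℂ = ⟪(u : H), (rep (star a) v : H)⟫_ℂ
  /-- the vacuum -/
  vac : dom
  norm_vac : ‖(vac : H)‖ = 1
  twoPoint : ∀ r j k s l n W, IsTwoPoint m (Φ r j k) (adj (Φ s l n)) W → ∀ f g,
    ⟪(vac : H), (rep (Φ r j k f) (rep (adj (Φ s l n) g) vac) : H)⟫_ℂ = W f g
  independent : ∀ f : κ → Fin 2 → Fin 2 → TestFn, IsAdmissible m f →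
    ∑ r, ∑ j, ∑ k, rep (adj (Φ r j k) (f r j k)) vac ≠ 0

end Fields

end SusyN2

end

noncomputable section

namespace SusyN2

/-! ### Fourier transforms on the mass hyperboloid -/

/-! For a supercharge `q`, a boson `b` and a fermion `ψ` with `[b, ψ] = 0`, the graded Jacobi
identity gives `{[q, b], ψ} = -[b, {q, ψ}]` (`graded_jacobi`), so each known bracket yields the next
one up the multiplet. From `[z, χ̄] = 0` and `[z, λ] = 0` come `{χ, χ̄} ∝ σ∂D_m` and `{χ, λ} ∝ α
D_m`. Varying `[C, χ] = 0` and `[C, χ̄] = 0` then gives `[C, C] ∝ α` (`hasBracket_C_C`) and `[C, C*]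
∝ 2m²` (`hasBracket_C_adj_C`), the mass coming from `σ ε σ ∂∂ = ε □` and the Klein-Gordon equation.

The map `C ↦ ε ε C*` (`flipAdj`) is an antilinear involution commuting with `SU(2)`. Its real and
imaginary parts `𝒞`, `𝒟`, with `C = 𝒞 - i𝒟`, diagonalise the commutators, with strengths `2m² + α`
and `2m² - α`.

Replacing `D_m` by `D_m⁽⁺⁾` turns the norm squared into a sum of `L²` norms on the mass hyperboloid
weighted by these strengths (`sum_twoPointFn`). It is positive exactly when both strengths are. In a
Hilbert space the same sum is the norm squared of a non-zero vector, hence the obstruction to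
representations. -/

/-- The on-shell momentum `(ω(p), p)` with lowered index, as a Euclidean vector. -/
def shellVec (m : ℝ) (p : Momentum) : Spacetime :=
  WithLp.toLp 2 (Fin.cons (energy m p) fun i => -p i)

theorem shellDot_eq_inner (m : ℝ) (p : Momentum) (x : Spacetime) :
    shellDot m p x = ⟪x, shellVec m p⟫_ℝ := by
  rw [shellDot, shellVec, PiLp.inner_apply, Fin.sum_univ_succ (n := 3)]
  simp [sub_eq_add_neg]

/-- The library kernel is `exp(-2πi⟨x, w⟩)`, hence the sign and the factor `(2π)⁻¹`. This makes the
decay and derivative rules of Schwartz Fourier transforms available on the hyperboloid. -/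
theorem upperShell_eq_fourier (m : ℝ) (f : TestFn) (p : Momentum) :
    upperShell m f p = FourierTransform.fourier f (-((2 * Real.pi)⁻¹ • shellVec m p)) := by
  rw [SchwartzMap.fourier_coe, Real.fourier_eq', upperShell]
  congr 1
  ext x
  rw [smul_eq_mul, mul_comm, shellDot_eq_inner, inner_neg_right, inner_smul_right]
  congr 2
  have : (Real.pi : ℂ) ≠ 0 := by exact_mod_cast Real.pi_ne_zero
  push_cast
  field_simp

theorem lowerShell_eq_fourier (m : ℝ) (f : TestFn) (p : Momentum) :
    lowerShell m f p = FourierTransform.fourier f ((2 * Real.pi)⁻¹ • shellVec m p) := by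
  rw [SchwartzMap.fourier_coe, Real.fourier_eq', lowerShell]
  congr 1
  ext x
  rw [smul_eq_mul, mul_comm, shellDot_eq_inner, inner_smul_right]
  congr 2
  have : (Real.pi : ℂ) ≠ 0 := by exact_mod_cast Real.pi_ne_zero
  push_cast
  field_simp

theorem lowerShell_conjTest (m : ℝ) (f : TestFn) (p : Momentum) :
    lowerShell m (conjTest f) p = (starRingEnd ℂ) (upperShell m f p) := by
  rw [lowerShell, upperShell, ← integral_conj]
  congr 1
  ext x
  simp [← Complex.exp_conj]

theorem conjTest_conjTest (f : TestFn) : conjTest (conjTest f) = f := by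
  ext x; simp

theorem upperShell_conjTest (m : ℝ) (f : TestFn) (p : Momentum) :
    upperShell m (conjTest f) p = (starRingEnd ℂ) (lowerShell m f p) := by
  conv_rhs => rw [← conjTest_conjTest f, lowerShell_conjTest]
  simp

theorem fourier_lineDeriv_single (f : TestFn) (μ : Fin 4) (w : Spacetime) :
    (FourierTransform.fourier (∂_{(EuclideanSpace.single μ (1 : ℝ) : Spacetime)} f) : TestFn) w =
      2 * Real.pi * I * (w μ) * (FourierTransform.fourier f : TestFn) w := by
  rw [SchwartzMap.fourier_lineDerivOp_eq]
  rw [smul_apply, SchwartzMap.smulLeftCLM_apply_apply (by fun_prop)]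
  simp [EuclideanSpace.inner_single_right]
  ring

/-- The derivative `∂_μ f` of a test function. -/
abbrev testPd (μ : Fin 4) (f : TestFn) : TestFn :=
  LineDeriv.lineDerivOpCLM ℂ TestFn (EuclideanSpace.single μ (1 : ℝ) : Spacetime) f

theorem upperShell_testPd (m : ℝ) (μ : Fin 4) (f : TestFn) (p : Momentum) :
    upperShell m (testPd μ f) p = -(I * shellVec m p μ * upperShell m f p) := by
  have : (Real.pi : ℂ) ≠ 0 := by exact_mod_cast Real.pi_ne_zero
  simp only [upperShell_eq_fourier, testPd, LineDeriv.lineDerivOpCLM_apply,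
    fourier_lineDeriv_single]
  simp
  field_simp
  simp

theorem lowerShell_testPd (m : ℝ) (μ : Fin 4) (f : TestFn) (p : Momentum) :
    lowerShell m (testPd μ f) p = I * shellVec m p μ * lowerShell m f p := by
  have : (Real.pi : ℂ) ≠ 0 := by exact_mod_cast Real.pi_ne_zero
  simp only [lowerShell_eq_fourier, testPd, LineDeriv.lineDerivOpCLM_apply,
    fourier_lineDeriv_single]
  simp
  field_simp
  simp

/-! ### Continuity, decay and `L²` norms on the mass hyperboloid. -/

theorem continuous_energy (m : ℝ) : Continuous (energy m) := by
  unfold energy; fun_prop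

theorem continuous_shellVec (m : ℝ) : Continuous (shellVec m) := by
  have := continuous_energy m
  refine (PiLp.continuous_toLp 2 _).comp (continuous_pi fun i => ?_)
  refine Fin.cases ?_ (fun i => ?_) i
  · simpa using this
  · simp only [Fin.cons_succ]; fun_prop

theorem norm_le_norm_shellVec (m : ℝ) (p : Momentum) : ‖p‖ ≤ ‖shellVec m p‖ := by
  rw [← abs_of_nonneg (norm_nonneg p), ← abs_of_nonneg (norm_nonneg (shellVec m p)), ← sq_le_sq,
    EuclideanSpace.norm_sq_eq, EuclideanSpace.norm_sq_eq, Fin.sum_univ_succ (n := 3)]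
  simp [shellVec]
  positivity

theorem continuous_upperShell (m : ℝ) (f : TestFn) : Continuous (upperShell m f) := by
  have := continuous_shellVec m
  simp_rw [funext (upperShell_eq_fourier m f)]
  exact (FourierTransform.fourier f : TestFn).continuous.comp (by fun_prop)

/-- Quadratic decay in `ℝ⁴` restricts to quadratic decay in `p`, because `‖p‖ ≤ ‖shellVec m p‖`. The
square then decays with exponent 4, more than the dimension 3 of momentum space. -/
theorem integrable_norm_sq_upperShell (m : ℝ) (f : TestFn) :
    Integrable fun p => ‖upperShell m f p‖ ^ 2 := by
  obtain ⟨C, hC⟩ : ∃ C : ℝ, ∀ w : Spacetime,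
      (1 + ‖w‖) ^ 2 * ‖(FourierTransform.fourier f : TestFn) w‖ ≤ C :=
    ⟨_, fun w => by
      simpa using SchwartzMap.one_add_le_sup_seminorm_apply (𝕜 := ℂ) (m := (2, 0)) (k := 2) (n := 0)
        le_rfl le_rfl (FourierTransform.fourier f : TestFn) w⟩
  have hdim : (Module.finrank ℝ Momentum : ℝ) < 4 := by simp; norm_num
  refine ((integrable_one_add_norm (μ := volume) hdim).const_mul
    (((2 * Real.pi) ^ 2 * C) ^ 2)).mono'
    ((continuous_upperShell m f).norm.pow 2).aestronglyMeasurable (.of_forall fun p => ?_)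
  have h1 := hC (-((2 * Real.pi)⁻¹ • shellVec m p))
  rw [← upperShell_eq_fourier, norm_neg, norm_smul, norm_inv, Real.norm_of_nonneg (by positivity)]
    at h1
  have hp := norm_le_norm_shellVec m p
  have h2 : 1 + ‖p‖ ≤ 2 * Real.pi * (1 + (2 * Real.pi)⁻¹ * ‖shellVec m p‖) := by
    have := Real.pi_gt_three
    rw [mul_add, ← mul_assoc, mul_inv_cancel₀ (by positivity)]
    linarith
  have h3 : (1 + ‖p‖) ^ 2 * ‖upperShell m f p‖ ≤ (2 * Real.pi) ^ 2 * C := by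
    calc (1 + ‖p‖) ^ 2 * ‖upperShell m f p‖
        ≤ (2 * Real.pi * (1 + (2 * Real.pi)⁻¹ * ‖shellVec m p‖)) ^ 2 * ‖upperShell m f p‖ := by
          gcongr
      _ = (2 * Real.pi) ^ 2 *
          ((1 + (2 * Real.pi)⁻¹ * ‖shellVec m p‖) ^ 2 * ‖upperShell m f p‖) := by ring
      _ ≤ _ := by gcongr
  have h4 : (1 + ‖p‖) ^ (-4 : ℝ) = ((1 + ‖p‖) ^ 4)⁻¹ := by
    rw [Real.rpow_neg (by positivity)]
    norm_cast
  rw [Real.norm_of_nonneg (by positivity), h4, ← div_eq_mul_inv, le_div_iff₀ (by positivity)]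
  calc ‖upperShell m f p‖ ^ 2 * (1 + ‖p‖) ^ 4 = ((1 + ‖p‖) ^ 2 * ‖upperShell m f p‖) ^ 2 := by ring
    _ ≤ _ := by gcongr

/-- The witness is the inverse Fourier transform of a bump centred at the point of the hyperboloid
over `p`. -/
theorem exists_upperShell_ne_zero (m : ℝ) (p : Momentum) : ∃ f : TestFn, upperShell m f p ≠ 0 := by
  set w : Spacetime := -((2 * Real.pi)⁻¹ • shellVec m p) with hw
  let b : ContDiffBump w := ⟨1, 2, by norm_num, by norm_num⟩
  have h1 : HasCompactSupport fun x => (b x : ℂ) :=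
    b.hasCompactSupport.comp_left (g := ((↑) : ℝ → ℂ)) (by simp)
  have h2 : ContDiff ℝ ((⊤ : ℕ∞) : WithTop ℕ∞) fun x => (b x : ℂ) :=
    Complex.ofRealCLM.contDiff.comp b.contDiff
  refine ⟨FourierTransformInv.fourierInv (h1.toSchwartzMap h2), ?_⟩
  rw [upperShell_eq_fourier, FourierTransform.fourier_fourierInv_eq, ← hw]
  simp [b.one_of_mem_closedBall (Metric.mem_closedBall_self b.rIn_pos.le)]

/-- The density `(2π)⁻³ / (2 ω(p))` of the invariant measure on the mass hyperboloid. -/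
def shellDensity (m : ℝ) (p : Momentum) : ℝ := ((2 * Real.pi) ^ 3 * (2 * energy m p))⁻¹

theorem energy_nonneg (m : ℝ) (p : Momentum) : 0 ≤ energy m p := Real.sqrt_nonneg _

theorem shellDensity_nonneg (m : ℝ) (p : Momentum) : 0 ≤ shellDensity m p := by
  have := energy_nonneg m p
  unfold shellDensity; positivity

/-- The invariant `L²` norm squared of the Fourier transform on the mass hyperboloid. -/
def shellNormSq (m : ℝ) (f : TestFn) : ℝ :=
  ∫ p : Momentum, shellDensity m p * ‖upperShell m f p‖ ^ 2

theorem shellNormSq_nonneg (m : ℝ) (f : TestFn) : 0 ≤ shellNormSq m f :=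
  integral_nonneg fun p => mul_nonneg (shellDensity_nonneg m p) (by positivity)

theorem energy_pos {m : ℝ} (hm : 0 < m) (p : Momentum) : 0 < energy m p :=
  Real.sqrt_pos.2 (by positivity)

theorem continuous_shellDensity {m : ℝ} (hm : 0 < m) : Continuous (shellDensity m) := by
  have := continuous_energy m
  unfold shellDensity
  refine Continuous.inv₀ (by fun_prop) fun p => ?_
  have := energy_pos hm p
  positivity

theorem shellNormSq_pos {m : ℝ} (hm : 0 < m) {f : TestFn} {p : Momentum}
    (hf : upperShell m f p ≠ 0) : 0 < shellNormSq m f := by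
  have hc : Continuous fun p => shellDensity m p * ‖upperShell m f p‖ ^ 2 :=
    (continuous_shellDensity hm).mul ((continuous_upperShell m f).norm.pow 2)
  refine integral_pos_of_integrable_nonneg_nonzero (x := p) hc ?_
    (fun p => mul_nonneg (shellDensity_nonneg m p) (by positivity)) ?_
  · refine ((integrable_norm_sq_upperShell m f).const_mul
      (((2 * Real.pi) ^ 3 * (2 * m))⁻¹)).mono' hc.aestronglyMeasurable (.of_forall fun p => ?_)
    -- This bounds the density uniformly; for `m = 0` it would be singular at `p = 0`.
    have hle : m ≤ energy m p := Real.le_sqrt_of_sq_le (by nlinarith [sq_nonneg ‖p‖])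
    rw [Real.norm_of_nonneg (mul_nonneg (shellDensity_nonneg m p) (by positivity)), shellDensity]
    gcongr
  · have := energy_pos hm p
    have : 0 < shellDensity m p := by unfold shellDensity; positivity
    have := norm_pos_iff.2 hf
    positivity

/-- Conjugating the test function turns the lower-shell transform into the conjugate of the upper
one, so the integrand becomes a square. All positivity statements rest on this. -/
theorem pauliJordanPos_conjTest_self (m : ℝ) (f : TestFn) :
    pauliJordanPos m (conjTest f) f = I * (shellNormSq m f : ℂ) := by
  rw [pauliJordanPos, shellNormSq, ← integral_complex_ofReal]
  congr 2
  ext p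
  rw [lowerShell_conjTest, Complex.conj_mul', shellDensity]
  push_cast
  ring

/-! ### Properties of the Pauli-Jordan distribution -/

theorem pauliJordan_swap (m : ℝ) (f g : TestFn) : pauliJordan m g f = -pauliJordan m f g := by
  simp [pauliJordan]

theorem pauliJordanPos_testPd_left (m : ℝ) (μ : Fin 4) (f g : TestFn) :
    pauliJordanPos m (testPd μ f) g = -pauliJordanPos m f (testPd μ g) := by
  rw [pauliJordanPos, pauliJordanPos, ← mul_neg, ← integral_neg]
  congr 2
  ext p
  rw [lowerShell_testPd, upperShell_testPd]
  ring

theorem pauliJordan_testPd_left (m : ℝ) (μ : Fin 4) (f g : TestFn) :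
    pauliJordan m (testPd μ f) g = -pauliJordan m f (testPd μ g) := by
  rw [pauliJordan, pauliJordan, pauliJordanPos_testPd_left, ← neg_inj,
    pauliJordanPos_testPd_left m μ g f]
  ring

theorem pauliJordanPos_testPd_comm (m : ℝ) (μ ν : Fin 4) (f g : TestFn) :
    pauliJordanPos m (testPd μ f) (testPd ν g) = pauliJordanPos m (testPd ν f) (testPd μ g) := by
  rw [pauliJordanPos, pauliJordanPos]
  congr 2
  ext p
  simp only [lowerShell_testPd, upperShell_testPd]
  ring

theorem pauliJordan_testPd_comm (m : ℝ) (μ ν : Fin 4) (f g : TestFn) :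
    pauliJordan m (testPd μ f) (testPd ν g) = pauliJordan m (testPd ν f) (testPd μ g) := by
  rw [pauliJordan, pauliJordan, pauliJordanPos_testPd_comm m μ ν f g,
    pauliJordanPos_testPd_comm m ν μ g f]

theorem pauliJordanPos_conjTest (m : ℝ) (f g : TestFn) :
    (starRingEnd ℂ) (pauliJordanPos m (conjTest f) (conjTest g)) = -pauliJordanPos m g f := by
  rw [pauliJordanPos, pauliJordanPos, map_mul, ← integral_conj, conj_I, neg_mul]
  congr 3
  ext p
  rw [lowerShell_conjTest, upperShell_conjTest, map_mul, map_mul, conj_conj, conj_conj, conj_ofReal]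
  ring

theorem pauliJordan_conjTest (m : ℝ) (f g : TestFn) :
    (starRingEnd ℂ) (pauliJordan m (conjTest f) (conjTest g)) = pauliJordan m f g := by
  rw [pauliJordan, pauliJordan, map_sub, pauliJordanPos_conjTest, pauliJordanPos_conjTest]
  ring

theorem shellVec_zero (m : ℝ) (p : Momentum) : shellVec m p 0 = energy m p := rfl

theorem ae_energy_ne_zero (m : ℝ) : ∀ᵐ p : Momentum, energy m p ≠ 0 := by
  have : ∀ᵐ p : Momentum, p ≠ 0 := by simp [ae_iff]
  filter_upwards [this] with p hp
  have := norm_pos_iff.2 hp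
  exact (Real.sqrt_pos.2 (by positivity)).ne'

/-- The equal-time commutation relation between a field and its time derivative. -/
theorem pauliJordanPos_conjTest_testPd_zero (m : ℝ) (f : TestFn) :
    pauliJordanPos m (conjTest f) (testPd 0 f) =
      ((2 * (2 * Real.pi) ^ 3)⁻¹ * ∫ p : Momentum, ‖upperShell m f p‖ ^ 2 : ℝ) := by
  rw [pauliJordanPos, ← integral_const_mul, ← integral_const_mul, ← integral_complex_ofReal]
  refine integral_congr_ae ?_
  filter_upwards [ae_energy_ne_zero m] with p hp
  rw [lowerShell_conjTest, upperShell_testPd, shellVec_zero]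
  have h1 : (energy m p : ℂ) ≠ 0 := by exact_mod_cast hp
  have h2 : (Real.pi : ℂ) ≠ 0 := by exact_mod_cast Real.pi_ne_zero
  push_cast
  rw [← Complex.conj_mul']
  field_simp
  simp

/-- The time derivative cancels `1/ω`, so the argument also covers `m = 0`. It also makes the two
frequency parts contribute with the same sign, so that they cannot cancel. -/
theorem exists_pauliJordan_ne_zero (m : ℝ) : ∃ f g, pauliJordan m f g ≠ 0 := by
  obtain ⟨f, hf⟩ := exists_upperShell_ne_zero m 0
  have hf' : 0 < ∫ p : Momentum, ‖upperShell m f p‖ ^ 2 :=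
    integral_pos_of_integrable_nonneg_nonzero (x := 0) ((continuous_upperShell m f).norm.pow 2)
      (integrable_norm_sq_upperShell m f) (fun p => by positivity) (by simpa using hf)
  have hg : 0 ≤ ∫ p : Momentum, ‖upperShell m (conjTest f) p‖ ^ 2 :=
    integral_nonneg fun p => by positivity
  have h : pauliJordanPos m (testPd 0 f) (conjTest f) =
      -pauliJordanPos m (conjTest (conjTest f)) (testPd 0 (conjTest f)) := by
    rw [pauliJordanPos_testPd_left, conjTest_conjTest]
  refine ⟨conjTest f, testPd 0 f, ?_⟩
  rw [pauliJordan, h, pauliJordanPos_conjTest_testPd_zero, pauliJordanPos_conjTest_testPd_zero,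
    sub_neg_eq_add, ← ofReal_add, ← mul_add, ofReal_ne_zero]
  exact mul_ne_zero (inv_ne_zero (mul_ne_zero two_ne_zero (pow_ne_zero _
    (mul_ne_zero two_ne_zero Real.pi_ne_zero)))) (by linarith)

/-! ### Adjoint fields and the decomposition into real tensors -/

section Covariance

variable {A : Type*} [Ring A] [StarRing A] [Algebra ℂ A]

theorem IsCovariant.add {V : Matrix.specialUnitaryGroup (Fin 2) ℂ →* unitary A}
    {X Y : Fin 2 → Fin 2 → Field A} (hX : IsCovariant V X) (hY : IsCovariant V Y) :
    IsCovariant V (X + Y) := by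
  intro U j k f
  simp only [Pi.add_apply, LinearMap.add_apply, mul_add, add_mul, hX U j k f, hY U j k f, smul_add,
    Finset.sum_add_distrib]

theorem IsCovariant.smul {V : Matrix.specialUnitaryGroup (Fin 2) ℂ →* unitary A} (c : ℂ)
    {X : Fin 2 → Fin 2 → Field A} (hX : IsCovariant V X) : IsCovariant V (c • X) := by
  intro U j k f
  simp only [Pi.smul_apply, LinearMap.smul_apply, mul_smul_comm, smul_mul_assoc, hX U j k f,
    Finset.smul_sum]
  simp only [smul_comm c]

end Covariance

section Adjoint

variable {A : Type*} [Ring A] [StarRing A] [Algebra ℂ A] [StarModule ℂ A]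

theorem adj_apply (φ : Field A) (f : TestFn) : adj φ f = star (φ (conjTest f)) := rfl

@[simp] theorem adj_adj (φ : Field A) : adj (adj φ) = φ := by
  ext f; simp [adj_apply, conjTest_conjTest]

@[simp] theorem adj_add (φ ψ : Field A) : adj (φ + ψ) = adj φ + adj ψ := by
  ext f; simp [adj_apply]

@[simp] theorem adj_smul (c : ℂ) (φ : Field A) : adj (c • φ) = (starRingEnd ℂ) c • adj φ := by
  ext f; simp [adj_apply]

theorem adj_anticommWith (X : A) (φ : Field A) :
    adj (anticommWith X φ) = anticommWith (star X) (adj φ) := by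
  ext f; simp [adj_apply, anticommWith, add_comm]

/-- The sign `ε² = -1` occurs once for each of the two indices and cancels. Thus `flipAdj` is a real
structure, and the reality condition says that a tensor is fixed by it. -/
theorem flipAdj_flipAdj (C : Fin 2 → Fin 2 → Field A) : flipAdj (flipAdj C) = C := by
  funext j k
  fin_cases j <;> fin_cases k <;> simp [flipAdj, eps, Fin.sum_univ_two] <;> module

theorem flipAdj_add (C D : Fin 2 → Fin 2 → Field A) :
    flipAdj (C + D) = flipAdj C + flipAdj D := by
  funext j k
  simp [flipAdj, Finset.sum_add_distrib]

theorem flipAdj_smul (c : ℂ) (C : Fin 2 → Fin 2 → Field A) :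
    flipAdj (c • C) = (starRingEnd ℂ) c • flipAdj C := by
  funext j k
  simp [flipAdj, smul_smul, mul_comm]

theorem isRealTensor_iff (X : Fin 2 → Fin 2 → Field A) : IsRealTensor X ↔ flipAdj X = X := by
  refine ⟨fun h => ?_, fun h j k => ?_⟩
  · funext j k
    have h' : ∀ j k, adj (X j k) = ∑ l, ∑ n, (eps j l * eps k n) • X l n := h
    simp only [flipAdj, h']
    fin_cases j <;> fin_cases k <;> simp [eps, Fin.sum_univ_two] <;> module
  · conv_lhs => rw [← h]
    fin_cases j <;> fin_cases k <;> simp [flipAdj, eps, Fin.sum_univ_two]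

theorem calC_eq (C : Fin 2 → Fin 2 → Field A) : calC C = (1 / 2 : ℂ) • (C + flipAdj C) := rfl

theorem calD_eq (C : Fin 2 → Fin 2 → Field A) :
    calD C = (I / 2) • (C + (-1 : ℂ) • flipAdj C) := by
  funext j k
  simp only [calD, Pi.smul_apply, Pi.add_apply]
  module

theorem isRealTensor_calC (C : Fin 2 → Fin 2 → Field A) : IsRealTensor (calC C) := by
  rw [isRealTensor_iff, calC_eq, flipAdj_smul, flipAdj_add, flipAdj_flipAdj, add_comm (flipAdj C)]
  simp only [map_div₀, map_one, map_ofNat]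

theorem isRealTensor_calD (C : Fin 2 → Fin 2 → Field A) : IsRealTensor (calD C) := by
  rw [isRealTensor_iff, calD_eq, flipAdj_smul, flipAdj_add, flipAdj_smul, flipAdj_flipAdj]
  simp only [map_div₀, conj_I, map_neg, map_one, map_ofNat]
  module

theorem IsSymm.flipAdj {C : Fin 2 → Fin 2 → Field A} (h : IsSymm C) : IsSymm (flipAdj C) := by
  intro j k
  have h01 := h 0 1
  fin_cases j <;> fin_cases k <;> simp [SusyN2.flipAdj, eps, Fin.sum_univ_two, h01]

theorem IsSymm.calC {C : Fin 2 → Fin 2 → Field A} (h : IsSymm C) : IsSymm (calC C) := fun j k => by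
  rw [SusyN2.calC, SusyN2.calC, h j k, h.flipAdj j k]

theorem IsSymm.calD {C : Fin 2 → Fin 2 → Field A} (h : IsSymm C) : IsSymm (calD C) := fun j k => by
  rw [SusyN2.calD, SusyN2.calD, h j k, h.flipAdj j k]

theorem calC_add_calD (C : Fin 2 → Fin 2 → Field A) : calC C + (-I) • calD C = C := by
  rw [calC_eq, calD_eq, smul_smul, show -I * (I / 2) = 1 / 2 by linear_combination (-1 / 2) * I_mul_I]
  module

theorem calC_add_smul {X Y : Fin 2 → Fin 2 → Field A} (hX : IsRealTensor X)
    (hY : IsRealTensor Y) : calC (X + (-I) • Y) = X := by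
  rw [isRealTensor_iff] at hX hY
  rw [calC_eq, flipAdj_add, flipAdj_smul, hX, hY, map_neg, conj_I]
  module

theorem calD_add_smul {X Y : Fin 2 → Fin 2 → Field A} (hX : IsRealTensor X)
    (hY : IsRealTensor Y) : calD (X + (-I) • Y) = Y := by
  rw [isRealTensor_iff] at hX hY
  rw [calD_eq, flipAdj_add, flipAdj_smul, hX, hY, map_neg, conj_I,
    show X + (-I) • Y + (-1 : ℂ) • (X + (- -I) • Y) = (-2 * I) • Y by module, smul_smul,
    show I / 2 * (-2 * I) = 1 by linear_combination -I_mul_I, one_smul]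

theorem bijOn_calC_calD : Set.BijOn (fun C : Fin 2 → Fin 2 → Field A => (calC C, calD C))
    {C | IsSymm C}
    {X | (IsSymm X.1 ∧ IsRealTensor X.1) ∧ (IsSymm X.2 ∧ IsRealTensor X.2)} := by
  refine ⟨fun C hC => ⟨⟨IsSymm.calC hC, isRealTensor_calC C⟩, IsSymm.calD hC, isRealTensor_calD C⟩,
    fun C _ C' _ h => ?_, fun X hX => ⟨X.1 + (-I) • X.2, fun j k => ?_, ?_⟩⟩
  · rw [Prod.mk.injEq] at h
    rw [← calC_add_calD C, h.1, h.2, calC_add_calD]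
  · simp [hX.1.1 j k, hX.2.1 j k]
  · exact Prod.ext (calC_add_smul hX.1.2 hX.2.2) (calD_add_smul hX.1.2 hX.2.2)

/-! ### Covariance under `SU(2)` -/

/-- The adjoint of `U` is its inverse, which is the adjugate as `det U = 1`. In other words `Ū = ε U
ε⁻¹`: the doublet is pseudo-real, which is why `flipAdj` preserves covariance. -/
theorem specialUnitary_two_conj (U : Matrix.specialUnitaryGroup (Fin 2) ℂ) :
    (starRingEnd ℂ) ((U : Matrix (Fin 2) (Fin 2) ℂ) 0 0) = (U : Matrix (Fin 2) (Fin 2) ℂ) 1 1 ∧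
    (starRingEnd ℂ) ((U : Matrix (Fin 2) (Fin 2) ℂ) 0 1) =
      -(U : Matrix (Fin 2) (Fin 2) ℂ) 1 0 ∧
    (starRingEnd ℂ) ((U : Matrix (Fin 2) (Fin 2) ℂ) 1 0) =
      -(U : Matrix (Fin 2) (Fin 2) ℂ) 0 1 ∧
    (starRingEnd ℂ) ((U : Matrix (Fin 2) (Fin 2) ℂ) 1 1) =
      (U : Matrix (Fin 2) (Fin 2) ℂ) 0 0 := by
  obtain ⟨hu, hdet⟩ := Matrix.mem_specialUnitaryGroup_iff.1 U.2
  have h1 : (U : Matrix (Fin 2) (Fin 2) ℂ) * (U : Matrix (Fin 2) (Fin 2) ℂ).adjugate = 1 := by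
    rw [Matrix.mul_adjugate, hdet, one_smul]
  have h2 : star (U : Matrix (Fin 2) (Fin 2) ℂ) = (U : Matrix (Fin 2) (Fin 2) ℂ).adjugate := by
    have h3 := (Matrix.mem_unitaryGroup_iff'.1 hu)
    calc _ = star (U : Matrix (Fin 2) (Fin 2) ℂ) *
          ((U : Matrix (Fin 2) (Fin 2) ℂ) * (U : Matrix (Fin 2) (Fin 2) ℂ).adjugate) := by
          rw [h1, mul_one]
      _ = _ := by rw [← mul_assoc, h3, one_mul]
  rw [Matrix.adjugate_fin_two] at h2
  have h (i j : Fin 2) := congrFun (congrFun h2 i) j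
  have h00 := h 0 0
  have h01 := h 0 1
  have h10 := h 1 0
  have h11 := h 1 1
  simp [Matrix.star_apply] at h00 h01 h10 h11
  exact ⟨h00, h10, h01, h11⟩

theorem IsCovariant.flipAdj {V : Matrix.specialUnitaryGroup (Fin 2) ℂ →* unitary A}
    {X : Fin 2 → Fin 2 → Field A} (hX : IsCovariant V X) : IsCovariant V (flipAdj X) := by
  intro U j k f
  have hadj (l n : Fin 2) : star (V U : A) * adj (X l n) f * (V U : A) =
      ∑ p, ∑ q, (starRingEnd ℂ) ((U : Matrix (Fin 2) (Fin 2) ℂ) l p *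
        (U : Matrix (Fin 2) (Fin 2) ℂ) n q) • adj (X p q) f := by
    have h := congrArg star (hX U l n (conjTest f))
    simpa [adj_apply, mul_assoc] using h
  obtain ⟨h00, h01, h10, h11⟩ := specialUnitary_two_conj U
  fin_cases j <;> fin_cases k <;>
  · simp [SusyN2.flipAdj, eps, Fin.sum_univ_two, hadj, h00, h01, h10, h11]
    try module

theorem IsCovariant.calC {V : Matrix.specialUnitaryGroup (Fin 2) ℂ →* unitary A}
    {X : Fin 2 → Fin 2 → Field A} (hX : IsCovariant V X) : IsCovariant V (calC X) := by
  rw [calC_eq]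
  exact (hX.add hX.flipAdj).smul _

theorem IsCovariant.calD {V : Matrix.specialUnitaryGroup (Fin 2) ℂ →* unitary A}
    {X : Fin 2 → Fin 2 → Field A} (hX : IsCovariant V X) : IsCovariant V (calD X) := by
  rw [calD_eq]
  exact (hX.add (hX.flipAdj.smul _)).smul _

end Adjoint

/-! ### Commutators and anticommutators of fields -/

section Brackets

variable {A : Type*} [Ring A] [Algebra ℂ A]

/-- The bracket `x y + s y x`: the commutator for `s = -1`, the anticommutator for `s = 1`. -/
def bracket (A : Type*) [Ring A] [Algebra ℂ A] (s : ℂ) : A →ₗ[ℂ] A →ₗ[ℂ] A :=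
  LinearMap.mul ℂ A + s • (LinearMap.mul ℂ A).flip

theorem bracket_apply (s : ℂ) (x y : A) : bracket A s x y = x * y + s • (y * x) := rfl

/-- The bracket of the fields `φ(x)` and `ψ(y)` is the multiple `K(x, y)` of the unit. -/
def HasBracket (s : ℂ) (φ ψ : Field A) (K : TestFn → TestFn → ℂ) : Prop :=
  ∀ f g, bracket A s (φ f) (ψ g) = algebraMap ℂ A (K f g)

theorem hasCommutator_iff {φ ψ : Field A} {K : TestFn → TestFn → ℂ} :
    HasCommutator φ ψ K ↔ HasBracket (-1) φ ψ K := by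
  simp [HasCommutator, HasBracket, bracket_apply, sub_eq_add_neg]

variable {s : ℂ} {φ φ' ψ ψ' : Field A} {K K' : TestFn → TestFn → ℂ}

theorem HasBracket.of_eq (h : HasBracket s φ ψ K) (e : ∀ f g, K f g = K' f g) :
    HasBracket s φ ψ K' := fun f g => by rw [h f g, e]

theorem HasBracket.swap (h : HasBracket s φ ψ K) (hs : s * s = 1) :
    HasBracket s ψ φ fun f g => s * K g f := fun f g => by
  rw [map_mul, ← h g f, ← Algebra.smul_def, bracket_apply, bracket_apply, smul_add, smul_smul, hs,
    one_smul, add_comm]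

theorem HasBracket.add_left (h : HasBracket s φ ψ K) (h' : HasBracket s φ' ψ K') :
    HasBracket s (φ + φ') ψ fun f g => K f g + K' f g := fun f g => by
  simp [h f g, h' f g]

theorem HasBracket.add_right (h : HasBracket s φ ψ K) (h' : HasBracket s φ ψ' K') :
    HasBracket s φ (ψ + ψ') fun f g => K f g + K' f g := fun f g => by
  simp [h f g, h' f g]

theorem HasBracket.smul_left (c : ℂ) (h : HasBracket s φ ψ K) :
    HasBracket s (c • φ) ψ fun f g => c * K f g := fun f g => by
  rw [LinearMap.smul_apply, map_smul, LinearMap.smul_apply, h, map_mul, Algebra.smul_def]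

theorem HasBracket.smul_right (c : ℂ) (h : HasBracket s φ ψ K) :
    HasBracket s φ (c • ψ) fun f g => c * K f g := fun f g => by
  rw [LinearMap.smul_apply, map_smul, h, map_mul, Algebra.smul_def]

theorem HasBracket.neg_left (h : HasBracket s φ ψ K) :
    HasBracket s (-φ) ψ fun f g => -K f g := fun f g => by
  simp [h f g]

theorem HasBracket.sub_right (h : HasBracket s φ ψ K) (h' : HasBracket s φ ψ' K') :
    HasBracket s φ (ψ - ψ') fun f g => K f g - K' f g := fun f g => by
  simp [h f g, h' f g]

theorem HasBracket.sum_left {ι : Type*} [Fintype ι] {Φ : ι → Field A}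
    {L : ι → TestFn → TestFn → ℂ} (h : ∀ i, HasBracket s (Φ i) ψ (L i)) :
    HasBracket s (∑ i, Φ i) ψ fun f g => ∑ i, L i f g := fun f g => by
  simp [fun i => h i f g]

theorem HasBracket.sum_right {ι : Type*} [Fintype ι] {Φ : ι → Field A}
    {L : ι → TestFn → TestFn → ℂ} (h : ∀ i, HasBracket s φ (Φ i) (L i)) :
    HasBracket s φ (∑ i, Φ i) fun f g => ∑ i, L i f g := fun f g => by
  simp [fun i => h i f g]

theorem pd_apply (μ : Fin 4) (φ : Field A) (f : TestFn) : pd μ φ f = -φ (testPd μ f) := rfl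

theorem HasBracket.pd_left (μ : Fin 4) (h : HasBracket s φ ψ K) :
    HasBracket s (pd μ φ) ψ fun f g => -K (testPd μ f) g := fun f g => by
  rw [pd_apply, map_neg, LinearMap.neg_apply, h, map_neg]

theorem HasBracket.pd_right (μ : Fin 4) (h : HasBracket s φ ψ K) :
    HasBracket s φ (pd μ ψ) fun f g => -K f (testPd μ g) := fun f g => by
  rw [pd_apply, map_neg, h, map_neg]

theorem HasBracket.sigmaPd_left (a b : Fin 2) (h : HasBracket s φ ψ K) :
    HasBracket s (sigmaPd a b φ) ψ fun f g => ∑ μ, sigma μ a b * -K (testPd μ f) g :=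
  HasBracket.sum_left fun μ => (h.pd_left μ).smul_left _

theorem HasBracket.sigmaPd_right (a b : Fin 2) (h : HasBracket s φ ψ K) :
    HasBracket s φ (sigmaPd a b ψ) fun f g => ∑ μ, sigma μ a b * -K f (testPd μ g) :=
  HasBracket.sum_right fun μ => (h.pd_right μ).smul_right _

theorem HasBracket.raise_left {χ : Fin 2 → Field A} {L : Fin 2 → TestFn → TestFn → ℂ}
    (h : ∀ a, HasBracket s (χ a) ψ (L a)) (a : Fin 2) :
    HasBracket s (raise χ a) ψ fun f g => ∑ b, epsUp a b * L b f g :=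
  HasBracket.sum_left fun b => (h b).smul_left _

/-- In a non-zero algebra the scalars embed, so identities between kernels can be read off from
identities between fields. -/
theorem HasBracket.unique [Nontrivial A] (h : HasBracket s φ ψ K) (h' : HasBracket s φ ψ K')
    (f g : TestFn) : K f g = K' f g :=
  (algebraMap ℂ A).injective ((h f g).symm.trans (h' f g))

/-- Here `q` and `ψ` are odd and `b` is even. When `[b, ψ] = 0` the right side vanishes, and either
bracket on the left determines the other. -/
theorem graded_jacobi (q b ψ : A) :
    bracket A 1 (q * b - b * q) ψ + bracket A (-1) b (q * ψ + ψ * q) =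
      q * bracket A (-1) b ψ + bracket A (-1) b ψ * q := by
  simp only [bracket_apply, neg_smul, one_smul]
  noncomm_ring

/-- Supersymmetry variation of `[φ(x), ψ(y)] = 0`, for a boson `φ` and a fermion `ψ`. -/
theorem HasBracket.variation {q : A} (h : HasBracket (-1) φ ψ fun _ _ => 0)
    (h' : HasBracket (-1) φ (anticommWith q ψ) K) :
    HasBracket 1 (commWith q φ) ψ fun f g => -K f g := fun f g => by
  have hj := graded_jacobi q (φ f) (ψ g)
  rw [h f g, map_zero, mul_zero, zero_mul, add_zero] at hj
  rw [map_neg, ← h' f g]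
  exact eq_neg_of_add_eq_zero_left hj

/-- Supersymmetry variation of `[φ(x), ψ(y)] = 0`, for a boson `φ` and a fermion `ψ`. -/
theorem HasBracket.variation' {q : A} (h : HasBracket (-1) φ ψ fun _ _ => 0)
    (h' : HasBracket 1 (commWith q φ) ψ K) :
    HasBracket (-1) φ (anticommWith q ψ) fun f g => -K f g := fun f g => by
  have hj := graded_jacobi q (φ f) (ψ g)
  rw [h f g, map_zero, mul_zero, zero_mul, add_zero] at hj
  rw [map_neg, ← h' f g]
  exact eq_neg_of_add_eq_zero_right hj

end Brackets

section Star

variable {A : Type*} [Ring A] [StarRing A] [Algebra ℂ A] [StarModule ℂ A]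

theorem HasBracket.adj_adj {φ ψ : Field A} {K : TestFn → TestFn → ℂ}
    (h : HasBracket (-1) φ ψ K) :
    HasBracket (-1) (adj φ) (adj ψ)
      fun f g => -(starRingEnd ℂ) (K (conjTest f) (conjTest g)) := fun f g => by
  have h1 := congrArg star (h (conjTest f) (conjTest g))
  rw [← algebraMap_star_comm] at h1
  rw [map_neg, starRingEnd_apply, ← h1]
  simp [bracket_apply, adj_apply]

theorem HasBracket.flipAdj_right {s : ℂ} {φ : Field A} {C : Fin 2 → Fin 2 → Field A}
    {L : Fin 2 → Fin 2 → TestFn → TestFn → ℂ}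
    (h : ∀ l n, HasBracket s φ (adj (C l n)) (L l n)) (l n : Fin 2) :
    HasBracket s φ (flipAdj C l n) fun f g => ∑ p, ∑ q, (eps l p * eps n q) * L p q f g :=
  HasBracket.sum_right fun p => HasBracket.sum_right fun q => (h p q).smul_right _

/-! ### The causal commutators of the multiplet -/

/-- The equation is inherited from `z`: the commutator of `(□ + m²) z = 0` with `z*` has zero
kernel. Moving one derivative onto `g` costs a sign, which puts the mass term on the right. -/
theorem IsFreeComplexScalar.pauliJordan_kleinGordon [Nontrivial A] {m : ℝ} {z : Field A}
    (hz : IsFreeComplexScalar m z) (f g : TestFn) :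
    pauliJordan m (testPd 0 f) (testPd 0 g) - ∑ i : Fin 3, pauliJordan m (testPd i.succ f)
      (testPd i.succ g) = m ^ 2 * pauliJordan m f g := by
  have h := hasCommutator_iff.1 hz.comm_adj
  have hp (μ : Fin 4) := (h.pd_left μ).pd_left μ
  have hs := ((hp 0).add_left (HasBracket.sum_left fun i : Fin 3 => hp i.succ).neg_left).add_left
    (h.smul_left ((m : ℂ) ^ 2))
  rw [← sub_eq_add_neg, hz.kleinGordon] at hs
  have h0 : HasBracket (-1) (0 : Field A) (adj z) fun _ _ => 0 := fun f g => by simp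
  have h1 := hs.unique h0 f g
  simp only [pauliJordan_testPd_left m _ (testPd _ f), Fin.sum_univ_three] at h1 ⊢
  linear_combination (-I) * h1 + (pauliJordan m (testPd 0 f) (testPd 0 g) -
    (pauliJordan m (testPd (Fin.succ 0) f) (testPd (Fin.succ 0) g) +
      pauliJordan m (testPd (Fin.succ 1) f) (testPd (Fin.succ 1) g) +
      pauliJordan m (testPd (Fin.succ 2) f) (testPd (Fin.succ 2) g)) -
      m ^ 2 * pauliJordan m f g) * I_mul_I

/-- The contraction `σ^μ_{ca} ε^{cd} σ^ν_{db} ∂_μ ∂_ν = ε^{ab} □`, applied to `D_m`. -/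
theorem IsFreeComplexScalar.sum_sigma_pauliJordan [Nontrivial A] {m : ℝ} {z : Field A}
    (hz : IsFreeComplexScalar m z) (a b : Fin 2) (f g : TestFn) :
    ∑ c, ∑ μ, ∑ d, ∑ ν, sigma μ c a * epsUp c d * sigma ν d b *
      pauliJordan m (testPd μ f) (testPd ν g) = epsUp a b * (m ^ 2 * pauliJordan m f g) := by
  rw [← hz.pauliJordan_kleinGordon f g]
  -- Derivatives commute, so only the part symmetric in `μ, ν` survives. Polarising `Sᵀ ε S = det(S)
  -- ε` for `S = k_μ σ^μ`, whose determinant is `k·k`, shows that this part is `ε` times the metric.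
  have h01 := pauliJordan_testPd_comm m 0 1 f g
  have h02 := pauliJordan_testPd_comm m 0 2 f g
  have h03 := pauliJordan_testPd_comm m 0 3 f g
  have h12 := pauliJordan_testPd_comm m 1 2 f g
  have h13 := pauliJordan_testPd_comm m 1 3 f g
  have h23 := pauliJordan_testPd_comm m 2 3 f g
  have e1 : (Fin.succ 0 : Fin 4) = 1 := rfl
  have e2 : (Fin.succ 1 : Fin 4) = 2 := rfl
  have e3 : (Fin.succ 2 : Fin 4) = 3 := rfl
  simp only [Fin.sum_univ_two, Fin.sum_univ_four, Fin.sum_univ_three, e1, e2, e3, h01, h02, h03,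
    h12, h13, h23]
  fin_cases a <;> fin_cases b <;> simp [sigma, epsUp, eps] <;> ring_nf

end Star

section Multiplet

variable {A : Type*} [Ring A] [StarRing A] [Algebra ℂ A] [StarModule ℂ A]
  {m : ℝ} {α : ℝ} (M : Multiplet A)

/-- Variation of `[z, χ̄] = 0`, using `{Q, χ̄} ∝ σ∂z*`. -/
theorem hasBracket_chi_adj_chi (hz : IsFreeComplexScalar m M.z) (j a k b : Fin 2) :
    HasBracket 1 (M.chi j a) (adj (M.chi k b)) fun f g =>
      2 * delta j k * ∑ μ, sigma μ a b * pauliJordan m f (testPd μ g) := by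
  have h0 := hasCommutator_iff.1
    (M.bose_fermi M.z (.inl rfl) (M.chi k b) (.inr ⟨k, b, rfl⟩)).2
  have h1 := ((hasCommutator_iff.1 hz.comm_adj).sigmaPd_right a b).smul_right (2 * delta j k)
  rw [← M.Q_chibar j a k b] at h1
  have h2 := (h0.variation h1).smul_left I
  rw [M.Q_z] at h2
  refine h2.of_eq fun f g => ?_
  simp only [neg_mul, neg_neg, Finset.mul_sum, ← Finset.sum_neg_distrib, mul_neg]
  refine Finset.sum_congr rfl fun μ _ => ?_
  linear_combination (-2 * delta j k * (sigma μ a b * pauliJordan m f (testPd μ g))) * I_mul_I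

/-- Variation of `[z, λ] = 0`; since `{Q, λ} ∝ D`, this is where `α` enters. -/
theorem hasBracket_chi_lam
    (hα : HasCommutator M.z M.d fun f g => (α : ℂ) * pauliJordan m f g) (j a k b : Fin 2) :
    HasBracket 1 (M.chi j a) (M.lam k b) fun f g =>
      -(I * α * (eps j k * eps a b) * pauliJordan m f g) := by
  have h0 := hasCommutator_iff.1
    (M.bose_fermi M.z (.inl rfl) (M.lam k b) (.inl ⟨k, b, rfl⟩)).1
  have h1 := (hasCommutator_iff.1 hα).smul_right (eps j k * eps a b)
  rw [← M.Q_lam j a k b] at h1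
  have h2 := (h0.variation h1).smul_left I
  rw [M.Q_z] at h2
  exact h2.of_eq fun f g => by ring

/-- Variation of `[C, χ] = 0`. On one side `[Q, C] ∝ λ` leads to `{λ, χ}`; on the other `{Q, χ} = εF
+ εC`. -/
theorem hasBracket_C_C
    (hα : HasCommutator M.z M.d fun f g => (α : ℂ) * pauliJordan m f g) (k l j n : Fin 2) :
    HasBracket (-1) (M.C k l) (M.C j n) fun f g =>
      I * α * (eps j k * eps l n + eps j l * eps k n) * pauliJordan m f g := by
  have h (a b : Fin 2) : HasBracket (-1) (M.C k l) (eps j n • M.F a b + eps a b • M.C j n)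
      fun f g => I * α * eps a b * (eps j k * eps l n + eps j l * eps k n) *
        pauliJordan m f g := by
    have h0 := hasCommutator_iff.1 (M.bose_fermi (M.C k l) (.inr (.inr (.inr ⟨k, l, rfl⟩)))
      (M.chi n b) (.inr ⟨n, b, rfl⟩)).1
    have hl (l : Fin 2) := (hasBracket_chi_lam M hα n b l a).swap (one_mul 1)
    have h1 := (((hl l).smul_left (eps j k)).add_left ((hl k).smul_left (eps j l))).neg_left
    rw [← M.Q_C j a k l] at h1
    have h2 := h0.variation' h1
    rw [M.Q_chi] at h2
    refine h2.of_eq fun f g => ?_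
    rw [pauliJordan_swap m f g, show eps b a = -eps a b by fin_cases a <;> fin_cases b <;> simp [eps],
      show eps n l = -eps l n by fin_cases l <;> fin_cases n <;> simp [eps],
      show eps n k = -eps k n by fin_cases k <;> fin_cases n <;> simp [eps]]
    ring
  -- `F` is symmetric in the spinor indices, so antisymmetrising removes it and isolates `C`.
  have h1 := ((h 0 1).sub_right (h 1 0)).smul_right (1 / 2)
  have h2 : (1 / 2 : ℂ) • (eps j n • M.F 0 1 + eps 0 1 • M.C j n -
      (eps j n • M.F 1 0 + eps 1 0 • M.C j n)) = M.C j n := by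
    rw [M.F_symm 1 0, show eps 0 1 = 1 from rfl, show eps 1 0 = -1 from rfl]
    module
  rw [h2] at h1
  refine h1.of_eq fun f g => ?_
  rw [show eps 0 1 = 1 from rfl, show eps 1 0 = -1 from rfl]
  ring

/-- Variation of `[C, χ̄] = 0` by `Q̄`. One `σ∂` comes from `[Q̄, C]` and one from `{χ, χ̄}`;
contracted they give `ε □`, that is, the mass term. The bracket `{Q̄, χ̄}` is the adjoint of `{Q,
χ}`, and `F*` drops out by antisymmetry as before. -/
theorem hasBracket_C_adj_C [Nontrivial A] (hz : IsFreeComplexScalar m M.z) (k l j n : Fin 2) :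
    HasBracket (-1) (M.C k l) (adj (M.C j n)) fun f g =>
      -(2 * I * m ^ 2 * (delta j k * delta l n + delta j l * delta k n) * pauliJordan m f g) := by
  have h (a b : Fin 2) : HasBracket (-1) (M.C k l)
      ((starRingEnd ℂ) (eps j n) • adj (M.F a b) + (starRingEnd ℂ) (eps a b) • adj (M.C j n))
      fun f g => 2 * I * m ^ 2 * epsUp a b * (delta j k * delta l n + delta j l * delta k n) *
        pauliJordan m f g := by
    have h0 := hasCommutator_iff.1 (M.bose_fermi (M.C k l) (.inr (.inr (.inr ⟨k, l, rfl⟩)))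
      (M.chi n b) (.inr ⟨n, b, rfl⟩)).2
    have hl (l c : Fin 2) := HasBracket.raise_left
      (fun d => hasBracket_chi_adj_chi M hz l d n b) c
    have h1 := (HasBracket.sum_left fun c => (((hl l c).smul_left (delta j k)).add_left
      ((hl k c).smul_left (delta j l))).sigmaPd_left c a).smul_left I
    rw [← M.Qbar_C j a k l] at h1
    have h2 := h0.variation' h1
    rw [← adj_anticommWith, M.Q_chi, adj_add, adj_smul, adj_smul] at h2
    refine h2.of_eq fun f g => ?_
    have hS := hz.sum_sigma_pauliJordan a b f g
    rw [show 2 * I * m ^ 2 * epsUp a b * (delta j k * delta l n + delta j l * delta k n) *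
      pauliJordan m f g = 2 * I * (delta j k * delta l n + delta j l * delta k n) *
        (epsUp a b * (m ^ 2 * pauliJordan m f g)) by ring, ← hS]
    simp only [Finset.mul_sum, ← Finset.sum_add_distrib, ← Finset.sum_neg_distrib]
    refine Finset.sum_congr rfl fun c _ => Finset.sum_congr rfl fun μ _ =>
      Finset.sum_congr rfl fun d _ => Finset.sum_congr rfl fun ν _ => ?_
    ring
  have h1 := ((h 0 1).sub_right (h 1 0)).smul_right (1 / 2)
  have h2 : (1 / 2 : ℂ) • ((starRingEnd ℂ) (eps j n) • adj (M.F 0 1) +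
      (starRingEnd ℂ) (eps 0 1) • adj (M.C j n) -
      ((starRingEnd ℂ) (eps j n) • adj (M.F 1 0) + (starRingEnd ℂ) (eps 1 0) • adj (M.C j n))) =
      adj (M.C j n) := by
    rw [M.F_symm 1 0, show eps 0 1 = 1 from rfl, show eps 1 0 = -1 from rfl, map_neg, map_one]
    module
  rw [h2] at h1
  refine h1.of_eq fun f g => ?_
  rw [epsUp, epsUp, show eps 0 1 = 1 from rfl, show eps 1 0 = -1 from rfl]
  ring

/-- Adjoint of `hasBracket_C_C`; the coefficient keeps its form because `α` is real. -/
theorem hasBracket_adj_C_adj_C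
    (hα : HasCommutator M.z M.d fun f g => (α : ℂ) * pauliJordan m f g) (k l j n : Fin 2) :
    HasBracket (-1) (adj (M.C k l)) (adj (M.C j n)) fun f g =>
      I * α * (eps j k * eps l n + eps j l * eps k n) * pauliJordan m f g := by
  have he (a b : Fin 2) : (starRingEnd ℂ) (eps a b) = eps a b := by
    fin_cases a <;> fin_cases b <;> simp [eps]
  refine (hasBracket_C_C M hα k l j n).adj_adj.of_eq fun f g => ?_
  simp only [map_mul, map_add, pauliJordan_conjTest, conj_I, conj_ofReal, he]
  ring

/-- The tensor `δ_{jl} δ_{kn} + δ_{jn} δ_{kl}`. -/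
def symDelta (j k l n : Fin 2) : ℂ := delta j l * delta k n + delta j n * delta k l

/-- Using `ε ε C*` instead of `C*` turns the `δδ` tensor into the `εε` tensor of `[C, C]`. All
commutators then differ only by a scalar, `α` or `2m²`. -/
theorem hasBracket_C_flipAdj_C [Nontrivial A] (hz : IsFreeComplexScalar m M.z) (k l j n : Fin 2) :
    HasBracket (-1) (M.C k l) (flipAdj M.C j n) fun f g =>
      -(2 * I * m ^ 2 * (eps j k * eps n l + eps j l * eps n k) * pauliJordan m f g) := by
  refine (HasBracket.flipAdj_right (hasBracket_C_adj_C M hz k l) j n).of_eq fun f g => ?_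
  simp only [Fin.sum_univ_two]
  fin_cases k <;> fin_cases l <;> simp [delta] <;> ring

theorem hasBracket_flipAdj_C_flipAdj_C
    (hα : HasCommutator M.z M.d fun f g => (α : ℂ) * pauliJordan m f g) (k l j n : Fin 2) :
    HasBracket (-1) (flipAdj M.C k l) (flipAdj M.C j n) fun f g =>
      I * α * (eps j k * eps l n + eps j l * eps k n) * pauliJordan m f g := by
  have h1 (k l : Fin 2) := HasBracket.flipAdj_right (hasBracket_adj_C_adj_C M hα k l) j n
  have h2 : HasBracket (-1) (flipAdj M.C k l) (flipAdj M.C j n) _ :=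
    HasBracket.sum_left fun p => HasBracket.sum_left fun q =>
      (h1 p q).smul_left (eps k p * eps l q)
  refine h2.of_eq fun f g => ?_
  simp only [Fin.sum_univ_two]
  fin_cases k <;> fin_cases l <;> fin_cases j <;> fin_cases n <;> simp [eps]

/-- All four commutators between `C`, `ε ε C*` combine into those of `a C + b ε ε C*`. -/
theorem hasBracket_combination [Nontrivial A] (hz : IsFreeComplexScalar m M.z)
    (hα : HasCommutator M.z M.d fun f g => (α : ℂ) * pauliJordan m f g) (a b a' b' : ℂ)
    (k l j n : Fin 2) :
    HasBracket (-1) (a • M.C k l + b • flipAdj M.C k l) (a' • M.C j n + b' • flipAdj M.C j n)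
      fun f g => I * ((a * a' + b * b') * α + (a * b' + b * a') * (2 * m ^ 2)) *
        (eps j k * eps l n + eps j l * eps k n) * pauliJordan m f g := by
  have h1 := ((hasBracket_C_C M hα k l j n).smul_right a').add_right
    ((hasBracket_C_flipAdj_C M hz k l j n).smul_right b')
  have h2 := ((((hasBracket_C_flipAdj_C M hz j n k l).swap (by norm_num)).smul_right a').add_right
    ((hasBracket_flipAdj_C_flipAdj_C M hα k l j n).smul_right b'))
  refine ((h1.smul_left a).add_left (h2.smul_left b)).of_eq fun f g => ?_
  have he (a b : Fin 2) : eps b a = -eps a b := by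
    fin_cases a <;> fin_cases b <;> simp [eps]
  rw [pauliJordan_swap m f g, he l n, he k n, he j k, he j l]
  ring

/-! ### Commutators of the real tensors `𝒞` and `𝒟`. -/

theorem hasBracket_calC_calC [Nontrivial A] (hz : IsFreeComplexScalar m M.z)
    (hα : HasCommutator M.z M.d fun f g => (α : ℂ) * pauliJordan m f g) (k l j n : Fin 2) :
    HasBracket (-1) (calC M.C k l) (calC M.C j n) fun f g =>
      I / 2 * (2 * m ^ 2 + α) * (eps j k * eps l n + eps j l * eps k n) * pauliJordan m f g := by
  rw [calC, calC, smul_add, smul_add]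
  exact (hasBracket_combination M hz hα _ _ _ _ k l j n).of_eq fun f g => by ring

theorem calD_apply (C : Fin 2 → Fin 2 → Field A) (k l : Fin 2) :
    calD C k l = (I / 2) • C k l + (-(I / 2)) • flipAdj C k l := by
  rw [calD]; module

/-- The form with `α` on the diagonal and `2m²` off it has eigenvectors `(1, 1)` and `(1, -1)`, with
eigenvalues `α + 2m²` and `α - 2m²`. The factor `i` in `𝒟` reverses the sign of the second. -/
theorem hasBracket_calD_calD [Nontrivial A] (hz : IsFreeComplexScalar m M.z)
    (hα : HasCommutator M.z M.d fun f g => (α : ℂ) * pauliJordan m f g) (k l j n : Fin 2) :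
    HasBracket (-1) (calD M.C k l) (calD M.C j n) fun f g =>
      I / 2 * (2 * m ^ 2 - α) * (eps j k * eps l n + eps j l * eps k n) * pauliJordan m f g := by
  rw [calD_apply, calD_apply]
  refine (hasBracket_combination M hz hα _ _ _ _ k l j n).of_eq fun f g => ?_
  linear_combination (I * (α / 2 - m ^ 2) * (eps j k * eps l n + eps j l * eps k n) *
    pauliJordan m f g) * I_mul_I

theorem hasBracket_calC_calD [Nontrivial A] (hz : IsFreeComplexScalar m M.z)
    (hα : HasCommutator M.z M.d fun f g => (α : ℂ) * pauliJordan m f g) (k l j n : Fin 2) :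
    HasBracket (-1) (calC M.C k l) (calD M.C j n) fun _ _ => 0 := by
  rw [calC, calD_apply, smul_add]
  exact (hasBracket_combination M hz hα _ _ _ _ k l j n).of_eq fun f g => by ring

/-- Reality makes the adjoint a linear combination of the components themselves, so brackets with
`X*` follow from those with `X`. -/
theorem HasBracket.adj_right_of_isRealTensor {φ : Field A} {X : Fin 2 → Fin 2 → Field A}
    (hX : IsRealTensor X) {L : Fin 2 → Fin 2 → TestFn → TestFn → ℂ}
    (h : ∀ l n, HasBracket (-1) φ (X l n) (L l n)) (l n : Fin 2) :
    HasBracket (-1) φ (adj (X l n)) fun f g => ∑ p, ∑ q, (eps l p * eps n q) * L p q f g := by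
  rw [hX l n]
  exact HasBracket.sum_right fun p => HasBracket.sum_right fun q => (h p q).smul_right _

theorem sum_eps_eq_symDelta (j k l n : Fin 2) (c d : ℂ) :
    ∑ p, ∑ q, (eps l p * eps n q) * (c * (eps p j * eps k q + eps p k * eps j q) * d) =
      -(c * symDelta j k l n * d) := by
  simp only [Fin.sum_univ_two, symDelta]
  fin_cases j <;> fin_cases k <;> fin_cases l <;> fin_cases n <;> simp [eps, delta] <;> ring

theorem hasBracket_calC_adj_calC [Nontrivial A] (hz : IsFreeComplexScalar m M.z)
    (hα : HasCommutator M.z M.d fun f g => (α : ℂ) * pauliJordan m f g) (j k l n : Fin 2) :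
    HasBracket (-1) (calC M.C j k) (adj (calC M.C l n)) fun f g =>
      -I * ((2 * m ^ 2 + α) / 2 * symDelta j k l n) * pauliJordan m f g := by
  refine (HasBracket.adj_right_of_isRealTensor (isRealTensor_calC M.C)
    (hasBracket_calC_calC M hz hα j k) l n).of_eq fun f g => ?_
  linear_combination sum_eps_eq_symDelta j k l n (I / 2 * (2 * m ^ 2 + α))
    (pauliJordan m f g)

theorem hasBracket_calD_adj_calD [Nontrivial A] (hz : IsFreeComplexScalar m M.z)
    (hα : HasCommutator M.z M.d fun f g => (α : ℂ) * pauliJordan m f g) (j k l n : Fin 2) :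
    HasBracket (-1) (calD M.C j k) (adj (calD M.C l n)) fun f g =>
      -I * ((2 * m ^ 2 - α) / 2 * symDelta j k l n) * pauliJordan m f g := by
  refine (HasBracket.adj_right_of_isRealTensor (isRealTensor_calD M.C)
    (hasBracket_calD_calD M hz hα j k) l n).of_eq fun f g => ?_
  linear_combination sum_eps_eq_symDelta j k l n (I / 2 * (2 * m ^ 2 - α))
    (pauliJordan m f g)

theorem hasBracket_calC_adj_calD [Nontrivial A] (hz : IsFreeComplexScalar m M.z)
    (hα : HasCommutator M.z M.d fun f g => (α : ℂ) * pauliJordan m f g) (j k l n : Fin 2) :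
    HasBracket (-1) (calC M.C j k) (adj (calD M.C l n)) fun _ _ => 0 :=
  (HasBracket.adj_right_of_isRealTensor (isRealTensor_calD M.C)
    (hasBracket_calC_calD M hz hα j k) l n).of_eq fun f g => by simp

theorem hasBracket_calD_adj_calC [Nontrivial A] (hz : IsFreeComplexScalar m M.z)
    (hα : HasCommutator M.z M.d fun f g => (α : ℂ) * pauliJordan m f g) (j k l n : Fin 2) :
    HasBracket (-1) (calD M.C j k) (adj (calC M.C l n)) fun _ _ => 0 :=
  (HasBracket.adj_right_of_isRealTensor (isRealTensor_calC M.C)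
    (fun p q => (hasBracket_calC_calD M hz hα p q j k).swap (by norm_num)) l n).of_eq
      fun f g => by simp

end Multiplet

/-! ### Positivity -/

section Positivity

/-- The coefficient of the commutators of `𝒞` and of `𝒟`. -/
def strength (m α : ℝ) : Fin 2 → ℝ := ![2 * m ^ 2 + α, 2 * m ^ 2 - α]

/-- The coefficient `c` in `[Φ_{r,jk}(x), Φ*_{s,ln}(y)] = -i c D_m(x - y)`, for `Φ = (𝒞, 𝒟)`. -/
def commCoeff (m α : ℝ) (r j k s l n : Fin 2) : ℂ :=
  if r = s then strength m α r / 2 * symDelta j k l n else 0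

/-- The two-point functions of `𝒞` and `𝒟`. -/
def twoPointFn (m α : ℝ) (r j k s l n : Fin 2) (f g : TestFn) : ℂ :=
  -I * commCoeff m α r j k s l n * pauliJordanPos m f g

/-- `symDelta` is twice the projection onto symmetric tensors; the 2 cancels the denominator in
`commCoeff`. -/
theorem sum_symDelta (j k : Fin 2) (X : Fin 2 → Fin 2 → ℂ) (h : ∀ l n, X l n = X n l) :
    ∑ l, ∑ n, symDelta j k l n * X l n = 2 * X j k := by
  have := h 0 1
  simp only [Fin.sum_univ_two, symDelta]
  fin_cases j <;> fin_cases k <;> simp only [delta, this, Fin.zero_eta, Fin.mk_one,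
    Fin.isValue, if_true, zero_ne_one, one_ne_zero, if_false] <;> ring

theorem sum_twoPointFn (m α : ℝ) (f : Fin 2 → Fin 2 → Fin 2 → TestFn)
    (hf : ∀ r j k, f r j k = f r k j) :
    ∑ r, ∑ j, ∑ k, ∑ s, ∑ l, ∑ n,
      twoPointFn m α r j k s l n (conjTest (f r j k)) (f s l n) =
      ((∑ r, ∑ j, ∑ k, strength m α r * shellNormSq m (f r j k) : ℝ) : ℂ) := by
  push_cast
  refine Finset.sum_congr rfl fun r _ => Finset.sum_congr rfl fun j _ =>
    Finset.sum_congr rfl fun k _ => ?_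
  rw [Finset.sum_eq_single r (fun s _ hs => by simp [twoPointFn, commCoeff, hs.symm]) (by simp)]
  have h := sum_symDelta j k (fun l n => pauliJordanPos m (conjTest (f r j k)) (f r l n))
    fun l n => by rw [hf r l n]
  calc ∑ l, ∑ n, twoPointFn m α r j k r l n (conjTest (f r j k)) (f r l n)
      = -I * (strength m α r / 2) * ∑ l, ∑ n, symDelta j k l n *
          pauliJordanPos m (conjTest (f r j k)) (f r l n) := by
        simp only [Finset.mul_sum, twoPointFn, commCoeff, if_true]
        refine Finset.sum_congr rfl fun l _ => Finset.sum_congr rfl fun n _ => by ring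
    _ = _ := by
        rw [h, pauliJordanPos_conjTest_self]
        linear_combination (-(strength m α r * shellNormSq m (f r j k) : ℂ)) * I_mul_I

/-- Since `D_m ≠ 0`, the commutator fixes the constant `c`. Hence the existential choice of `W` in
`PositivityCondition` leaves no freedom. -/
theorem IsTwoPoint.unique {A : Type*} [Ring A] [Algebra ℂ A] [Nontrivial A] {m : ℝ}
    {φ ψ : Field A} {W W' : TestFn → TestFn → ℂ} (h : IsTwoPoint m φ ψ W) (h' : IsTwoPoint m φ ψ W') : W = W' := by
  obtain ⟨c, hc, hW⟩ := h
  obtain ⟨c', hc', hW'⟩ := h'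
  obtain ⟨f, g, hfg⟩ := exists_pauliJordan_ne_zero m
  have h1 := (hasCommutator_iff.1 hc).unique (hasCommutator_iff.1 hc') f g
  have h2 : c = c' := mul_left_cancel₀ (neg_ne_zero.2 I_ne_zero) (mul_right_cancel₀ hfg h1)
  funext f g
  rw [hW, hW', h2]

variable {A : Type*} [Ring A] [StarRing A] [Algebra ℂ A] [StarModule ℂ A] {m : ℝ}

/-- The sum of two-point functions is the expansion of `‖Ψ‖²`: moving `Φ*(f)` across the inner
product gives `Φ(f̄)`, which accounts for `conjTest`. Independence makes `Ψ` non-zero. -/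
theorem FockRepresentation.positivityCondition {κ : Type*} [Fintype κ]
    {Φ : κ → Fin 2 → Fin 2 → Field A} {H : Type*} [NormedAddCommGroup H] [InnerProductSpace ℂ H]
    [CompleteSpace H] (R : FockRepresentation m Φ H)
    {W : κ → Fin 2 → Fin 2 → κ → Fin 2 → Fin 2 → TestFn → TestFn → ℂ}
    (hW : ∀ r j k s l n, IsTwoPoint m (Φ r j k) (adj (Φ s l n)) (W r j k s l n)) :
    PositivityCondition m Φ := by
  refine ⟨W, hW, fun f hf => ?_⟩
  set Ψ : R.dom := ∑ r, ∑ j, ∑ k, R.rep (adj (Φ r j k) (f r j k)) R.vac with hΨ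
  have hne : Ψ ≠ 0 := R.independent f hf
  refine ⟨‖(Ψ : H)‖ ^ 2, by have := norm_pos_iff.2 (Subtype.coe_ne_coe.2 hne); positivity, ?_⟩
  have hcoe : (Ψ : H) = ∑ r, ∑ j, ∑ k, (R.rep (adj (Φ r j k) (f r j k)) R.vac : H) := by
    simp [hΨ]
  rw [ofReal_pow, ← coe_algebraMap, ← inner_self_eq_norm_sq_to_K (𝕜 := ℂ), hcoe]
  simp only [sum_inner]
  simp only [inner_sum]
  refine Finset.sum_congr rfl fun r _ => Finset.sum_congr rfl fun j _ =>
    Finset.sum_congr rfl fun k _ => Finset.sum_congr rfl fun s _ => Finset.sum_congr rfl fun l _ =>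
    Finset.sum_congr rfl fun n _ => ?_
  rw [R.rep_star, ← R.twoPoint r j k s l n _ (hW r j k s l n), adj_apply (Φ r j k), star_star]

variable [Nontrivial A] {α : ℝ} (M : Multiplet A)

theorem hasBracket_calC_calD_adj (hz : IsFreeComplexScalar m M.z)
    (hα : HasCommutator M.z M.d fun f g => (α : ℂ) * pauliJordan m f g) (r j k s l n : Fin 2) :
    HasBracket (-1) (![calC M.C, calD M.C] r j k) (adj (![calC M.C, calD M.C] s l n))
      fun f g => -I * commCoeff m α r j k s l n * pauliJordan m f g := by
  fin_cases r <;> fin_cases s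
  · refine (hasBracket_calC_adj_calC M hz hα j k l n).of_eq fun f g => ?_
    simp [commCoeff, strength]
  · refine (hasBracket_calC_adj_calD M hz hα j k l n).of_eq fun f g => ?_
    simp [commCoeff]
  · refine (hasBracket_calD_adj_calC M hz hα j k l n).of_eq fun f g => ?_
    simp [commCoeff]
  · refine (hasBracket_calD_adj_calD M hz hα j k l n).of_eq fun f g => ?_
    simp [commCoeff, strength]

theorem isTwoPoint_twoPointFn (hz : IsFreeComplexScalar m M.z)
    (hα : HasCommutator M.z M.d fun f g => (α : ℂ) * pauliJordan m f g) (r j k s l n : Fin 2) :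
    IsTwoPoint m (![calC M.C, calD M.C] r j k) (adj (![calC M.C, calD M.C] s l n))
      (twoPointFn m α r j k s l n) :=
  ⟨commCoeff m α r j k s l n, hasCommutator_iff.2 (hasBracket_calC_calD_adj M hz hα r j k s l n),
    fun _ _ => rfl⟩

theorem strength_pos_iff : (∀ r, 0 < strength m α r) ↔ -(2 * m ^ 2) < α ∧ α < 2 * m ^ 2 := by
  simp only [Fin.forall_fin_two, strength, Matrix.cons_val_zero, Matrix.cons_val_one]
  constructor <;> rintro ⟨h1, h2⟩ <;> constructor <;> linarith

theorem positivityCondition_iff (hm : 0 ≤ m) (hz : IsFreeComplexScalar m M.z)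
    (hα : HasCommutator M.z M.d fun f g => (α : ℂ) * pauliJordan m f g) :
    PositivityCondition m ![calC M.C, calD M.C] ↔ -(2 * m ^ 2) < α ∧ α < 2 * m ^ 2 := by
  rw [← strength_pos_iff]
  constructor
  · rintro ⟨W, hW, hpos⟩ r₀
    obtain ⟨f, hf⟩ := exists_upperShell_ne_zero m 0
    -- Exciting a single species, with equal and hence symmetric components, isolates the strength
    -- of `r₀`.
    let f' : Fin 2 → Fin 2 → Fin 2 → TestFn := fun r _ _ => if r = r₀ then f else 0
    obtain ⟨N, hN, hsum⟩ := hpos f' ⟨fun r j k => rfl, r₀, 0, 0, 0, by simpa [f'] using hf⟩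
    simp only [fun r j k s l n =>
      (hW r j k s l n).unique (isTwoPoint_twoPointFn M hz hα r j k s l n)] at hsum
    rw [sum_twoPointFn m α f' fun r j k => rfl, ofReal_inj] at hsum
    have hzero : shellNormSq m 0 = 0 := by simp [shellNormSq, upperShell]
    rw [Finset.sum_eq_single r₀ (fun r _ hr => by simp [f', hr, hzero]) (by simp)] at hsum
    simp only [f', if_true, Fin.sum_univ_two] at hsum
    -- Non-negativity of the shell norm suffices here, so `m = 0` needs no separate treatment.
    exact pos_of_mul_pos_left (by linarith) (shellNormSq_nonneg m f)
  · intro hs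
    -- For `m = 0` the open interval for `α` is empty.
    have hm' : 0 < m := by
      have h := strength_pos_iff.1 hs
      refine hm.lt_of_ne fun h0 => ?_
      rw [← h0] at h
      linarith [h.1, h.2]
    refine ⟨twoPointFn m α, isTwoPoint_twoPointFn M hz hα, fun f ⟨hf, r, j, k, p, hp⟩ =>
      ⟨_, ?_, sum_twoPointFn m α f hf⟩⟩
    have h0 (r j k : Fin 2) : 0 ≤ strength m α r * shellNormSq m (f r j k) :=
      mul_nonneg (hs r).le (shellNormSq_nonneg m _)
    refine Finset.sum_pos' (fun r _ => Finset.sum_nonneg fun j _ => Finset.sum_nonneg fun k _ =>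
      h0 r j k) ⟨r, Finset.mem_univ r, ?_⟩
    refine Finset.sum_pos' (fun j _ => Finset.sum_nonneg fun k _ => h0 r j k)
      ⟨j, Finset.mem_univ j, ?_⟩
    exact Finset.sum_pos' (fun k _ => h0 r j k) ⟨k, Finset.mem_univ k,
      mul_pos (hs r) (shellNormSq_pos hm' hp)⟩

end Positivity

end SusyN2

end

theorem mainTheorem4 {A : Type*} [Ring A] [StarRing A] [Algebra ℂ A] [StarModule ℂ A]
    [Nontrivial A] (m : ℝ) (hm : 0 ≤ m) (α : ℝ) (M : SusyN2.Multiplet A)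
    (hz : SusyN2.IsFreeComplexScalar m M.z)
    (hα : SusyN2.HasCommutator M.z M.d (fun f g => (α : ℂ) * SusyN2.pauliJordan m f g)) :
    -- the correspondence is one-one
    Set.BijOn (fun C : Fin 2 → Fin 2 → SusyN2.Field A => (SusyN2.calC C, SusyN2.calD C))
      {C | SusyN2.IsSymm C}
      {X | (SusyN2.IsSymm X.1 ∧ SusyN2.IsRealTensor X.1) ∧
        (SusyN2.IsSymm X.2 ∧ SusyN2.IsRealTensor X.2)} ∧
    -- it is compatible with the action of `SU(2)`
    (∀ V : Matrix.specialUnitaryGroup (Fin 2) ℂ →* unitary A, SusyN2.IsCovariant V M.C →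
      SusyN2.IsCovariant V (SusyN2.calC M.C) ∧ SusyN2.IsCovariant V (SusyN2.calD M.C)) ∧
    -- reality conditions
    SusyN2.IsRealTensor (SusyN2.calC M.C) ∧
    SusyN2.IsRealTensor (SusyN2.calD M.C) ∧
    -- causal commutators
    (∀ j k l n, SusyN2.HasCommutator (SusyN2.calC M.C j k) (SusyN2.adj (SusyN2.calC M.C l n))
      (fun f g => -(Complex.I / 2) * (2 * (m : ℂ) ^ 2 + α) *
        (SusyN2.delta j l * SusyN2.delta k n + SusyN2.delta j n * SusyN2.delta k l) *
        SusyN2.pauliJordan m f g)) ∧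
    (∀ j k l n, SusyN2.HasCommutator (SusyN2.calD M.C j k) (SusyN2.adj (SusyN2.calD M.C l n))
      (fun f g => -(Complex.I / 2) * (2 * (m : ℂ) ^ 2 - α) *
        (SusyN2.delta j l * SusyN2.delta k n + SusyN2.delta j n * SusyN2.delta k l) *
        SusyN2.pauliJordan m f g)) ∧
    (∀ j k l n, SusyN2.HasCommutator (SusyN2.calC M.C j k) (SusyN2.calD M.C l n)
      (fun _ _ => 0)) ∧
    -- positivity
    (SusyN2.PositivityCondition m ![SusyN2.calC M.C, SusyN2.calD M.C] ↔
      -(2 * m ^ 2) < α ∧ α < 2 * m ^ 2) ∧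
    -- Hilbert space representations
    (∀ (H : Type*) [NormedAddCommGroup H] [InnerProductSpace ℂ H] [CompleteSpace H],
      (Nonempty (SusyN2.FockRepresentation m ![SusyN2.calC M.C, SusyN2.calD M.C] H) →
        -(2 * m ^ 2) < α ∧ α < 2 * m ^ 2) ∧
      (α = 2 * m ^ 2 →
        IsEmpty (SusyN2.FockRepresentation m ![SusyN2.calC M.C, SusyN2.calD M.C] H))) := by
  have hpos := SusyN2.positivityCondition_iff M hm hz hα
  refine ⟨SusyN2.bijOn_calC_calD, fun V hV => ⟨hV.calC, hV.calD⟩,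
    SusyN2.isRealTensor_calC M.C, SusyN2.isRealTensor_calD M.C, fun j k l n => ?_,
    fun j k l n => ?_, fun j k l n => ?_, hpos,
    fun H _ _ _ => ?_⟩
  · refine SusyN2.hasCommutator_iff.2
      ((SusyN2.hasBracket_calC_adj_calC M hz hα j k l n).of_eq fun f g => ?_)
    rw [SusyN2.symDelta]
    ring
  · refine SusyN2.hasCommutator_iff.2
      ((SusyN2.hasBracket_calD_adj_calD M hz hα j k l n).of_eq fun f g => ?_)
    rw [SusyN2.symDelta]
    ring
  · exact SusyN2.hasCommutator_iff.2 (SusyN2.hasBracket_calC_calD M hz hα j k l n)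
  · have hrep (R : SusyN2.FockRepresentation m ![SusyN2.calC M.C, SusyN2.calD M.C] H) :=
      hpos.1 (R.positivityCondition (SusyN2.isTwoPoint_twoPointFn M hz hα))
    exact ⟨fun ⟨R⟩ => hrep R, fun h => ⟨fun R => (hrep R).2.ne h⟩⟩
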